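/- Let $J_0(t)=\frac{2}{\pi}\int_0^{\pi/2}\cos(t\cos\varphi)\,d\varphi$ be the Bessel function of the first kind of order zero, and let $$p_5(x)=\int_0^\infty J_0(xt)\,[J_0(t)]^5\,xt\,dt$$ be Kluyver's probability density of the distance travelled in a 5-step uniform random walk with unit steps in the Euclidean plane; the integral converges absolutely for every real $x$. The one-sided limit $p_5'(0^+)=\lim_{x\to0^+}p_5'(x)$ exists, and $p_5$ has, for all sufficiently small $x\ge 0$, a convergent Maclaurin expansion $p_5(x)=\sum_{k=0}^\infty r_{5,k}\,x^{2k+1}$ with uniquely determined real coefficients $r_{5,k}$. Then $$p_5'(0^+)<p_5(1).$$ More precisely, $$p_5(1)-p_5'(0^+)>r_{5,1}=0.006616730259\ldots,$$ where the value of $r_{5,1}$ means that $0.006616730259\le r_{5,1}<0.006616730260$. -/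

import Mathlib

/-- The Bessel function of the first kind and zeroth order,
`J₀(t) = (2/π) ∫_0^{π/2} cos (t cos φ) dφ`. -/
noncomputable def besselJ0 (t : ℝ) : ℝ :=
  2 / Real.pi * ∫ φ in (0 : ℝ)..(Real.pi / 2), Real.cos (t * Real.cos φ)

/-- The integrand `J₀(x t) J₀(t)⁵ x t` in Kluyver's formula for five steps. -/
noncomputable def kluyverIntegrand5 (x t : ℝ) : ℝ :=
  besselJ0 (x * t) * besselJ0 t ^ 5 * (x * t)

/-- Kluyver's probability density `p₅` of the distance travelled in a 5-step planar uniform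
random walk, `p₅(x) = ∫_0^∞ J₀(x t) J₀(t)⁵ x t dt`. -/
noncomputable def kluyverP5 (x : ℝ) : ℝ :=
  ∫ t in Set.Ioi (0 : ℝ), kluyverIntegrand5 x t

/-- `IsDerivZeroPlus f L`: the one-sided limit `f'(0⁺) = lim_{x → 0⁺} f'(x)` exists and is `L`.
(Differentiability near `0⁺` is included, as `deriv` is `0` by convention elsewhere.) -/
def IsDerivZeroPlus (f : ℝ → ℝ) (L : ℝ) : Prop :=
  (∀ᶠ x in nhdsWithin (0 : ℝ) (Set.Ioi 0), DifferentiableAt ℝ f x) ∧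
    Filter.Tendsto (deriv f) (nhdsWithin (0 : ℝ) (Set.Ioi 0)) (nhds L)

/-- `IsOddMaclaurinExpansion f r`: one has `f(x) = ∑_{k ≥ 0} r_k x^{2k+1}` for all sufficiently
small `x ≥ 0`; the coefficients `r_k` are uniquely determined by this. -/
def IsOddMaclaurinExpansion (f : ℝ → ℝ) (r : ℕ → ℝ) : Prop :=
  ∃ δ : ℝ, 0 < δ ∧ ∀ x ∈ Set.Ico (0 : ℝ) δ, HasSum (fun k : ℕ => r k * x ^ (2 * k + 1)) (f x)

open Real MeasureTheory Set Filter Topology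

/-! Kluyver's integrand oscillates, but for `0 ≤ x < 1` the ray of integration can be turned from
the positive real to the positive imaginary axis. Write `2J₀ = H + H'` with `H`, `H'` the two Hankel
functions, conjugate to each other on the positive real axis. In the expansion of `(H + H')⁵` the
three terms with at least three factors `H` have real part `16 J₀⁵` there. They decay in the upper
half plane even after multiplication by `J₀(xz)`, because the worst product `H³ H'² J₀(xz)` is
essentially of size `exp(-(1 - x) Im z)`. On the imaginary axis `H` turns into `K₀` and `J₀` into
`I₀`, and what survives is `p₅(x) = (30/π⁴) x ∫₀^∞ s I₀(xs) I₀(s) K₀(s)⁴ ds`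
(`kluyverP5_eq_integral`).

Here everything is positive. Expanding `I₀(xs)` gives `p₅(x) = ∑ r_k x^(2k+1)` on `[0, 1)` with `r_k
= (30/π⁴) (4^k k!²)⁻¹ ∫ s^(2k+1) I₀ K₀⁴ > 0`, and `r_0 = p₅'(0⁺)`. Letting `x → 1⁻`, by continuity
of `p₅`, yields `r_0 + r_1 + r_2 ≤ p₅(1)` (`sum_kluyverCoeff5_le_kluyverP5_one`); both inequalities
follow.

For the digits of `r_1`, the remaining `I₀(s)` is expanded too, which leaves the odd moments of
`K₀⁴`. Integration by parts gives them a three-term recurrence (`besselMoment_four_rec`) and one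
inhomogeneous relation (`besselMoment_four_three`). They form a minimal solution, so running the
recurrence backwards from a crude bound pins down the ratios of consecutive moments
(`oddMoment_ratio_step`); the inhomogeneous relation then fixes the scale. -/

/-! ### Bessel's equation and the decay of `J₀`. -/

/-- The derivative of `besselJ0`. -/
noncomputable def besselJ0Deriv (t : ℝ) : ℝ :=
  2 / Real.pi * ∫ φ in (0 : ℝ)..(Real.pi / 2), -(Real.cos φ * Real.sin (t * Real.cos φ))

theorem hasDerivAt_besselJ0 (t : ℝ) : HasDerivAt besselJ0 (besselJ0Deriv t) t := by
  have h := (intervalIntegral.hasDerivAt_integral_of_dominated_loc_of_deriv_le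
    (μ := volume) (a := 0) (b := π / 2)
    (F := fun t φ => Real.cos (t * Real.cos φ))
    (F' := fun t φ => -(Real.cos φ * Real.sin (t * Real.cos φ)))
    (bound := fun _ => 1) (x₀ := t) (s := univ) univ_mem ?_ ?_ ?_ ?_ ?_ ?_).2
  · exact h.const_mul (2 / π)
  · exact Eventually.of_forall fun t =>
      Continuous.aestronglyMeasurable (by fun_prop)
  · exact Continuous.intervalIntegrable (by fun_prop) _ _
  · exact Continuous.aestronglyMeasurable (by fun_prop)
  · refine Eventually.of_forall fun φ _ x _ => ?_
    rw [norm_neg, norm_mul]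
    exact mul_le_one₀ (Real.abs_cos_le_one _) (norm_nonneg _) (Real.abs_sin_le_one _)
  · exact intervalIntegrable_const
  · refine Eventually.of_forall fun φ _ x _ => ?_
    exact ((hasDerivAt_mul_const (x := x) (Real.cos φ)).cos).congr_deriv (by ring)

theorem hasDerivAt_besselJ0Deriv (t : ℝ) : HasDerivAt besselJ0Deriv
    (2 / π * ∫ φ in (0 : ℝ)..(π / 2), -(Real.cos φ ^ 2 * Real.cos (t * Real.cos φ))) t := by
  have h := (intervalIntegral.hasDerivAt_integral_of_dominated_loc_of_deriv_le
    (μ := volume) (a := 0) (b := π / 2)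
    (F := fun t φ => -(Real.cos φ * Real.sin (t * Real.cos φ)))
    (F' := fun t φ => -(Real.cos φ ^ 2 * Real.cos (t * Real.cos φ)))
    (bound := fun _ => 1) (x₀ := t) (s := univ) univ_mem ?_ ?_ ?_ ?_ ?_ ?_).2
  · exact h.const_mul (2 / π)
  · exact Eventually.of_forall fun t =>
      Continuous.aestronglyMeasurable (by fun_prop)
  · exact Continuous.intervalIntegrable (by fun_prop) _ _
  · exact Continuous.aestronglyMeasurable (by fun_prop)
  · refine Eventually.of_forall fun φ _ x _ => ?_
    rw [norm_neg, norm_mul, norm_pow]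
    exact mul_le_one₀ (pow_le_one₀ (norm_nonneg _) (Real.abs_cos_le_one _)) (norm_nonneg _)
      (Real.abs_cos_le_one _)
  · exact intervalIntegrable_const
  · refine Eventually.of_forall fun φ _ x _ => ?_
    exact (((hasDerivAt_mul_const (x := x) (Real.cos φ)).sin).const_mul (Real.cos φ)).neg.congr_deriv
      (by ring)

/-- Bessel's equation `t J₀'' + J₀' + t J₀ = 0`. -/
theorem besselJ0_ode (t : ℝ) :
    t * (2 / π * ∫ φ in (0 : ℝ)..(π / 2), -(Real.cos φ ^ 2 * Real.cos (t * Real.cos φ)))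
      + besselJ0Deriv t + t * besselJ0 t = 0 := by
  have h : ∫ φ in (0 : ℝ)..(π / 2), (t * -(Real.cos φ ^ 2 * Real.cos (t * Real.cos φ))
      + -(Real.cos φ * Real.sin (t * Real.cos φ)) + t * Real.cos (t * Real.cos φ)) = 0 := by
    -- The combined integrand is an exact derivative whose primitive vanishes at both endpoints.
    have := intervalIntegral.integral_eq_sub_of_hasDerivAt (a := 0) (b := π / 2)
      (f := fun φ => -(Real.sin φ * Real.sin (t * Real.cos φ)))
      (f' := fun φ => t * -(Real.cos φ ^ 2 * Real.cos (t * Real.cos φ))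
        + -(Real.cos φ * Real.sin (t * Real.cos φ)) + t * Real.cos (t * Real.cos φ)) ?_ ?_
    · rw [this]; simp
    · intro φ _
      refine ((Real.hasDerivAt_sin φ).mul (((Real.hasDerivAt_cos φ).const_mul t).sin)).neg.congr_deriv ?_
      have := Real.sin_sq_add_cos_sq φ
      linear_combination (t * Real.cos (t * Real.cos φ)) * this
    · exact Continuous.intervalIntegrable (by fun_prop) _ _
  rw [intervalIntegral.integral_add, intervalIntegral.integral_add,
    intervalIntegral.integral_const_mul, intervalIntegral.integral_const_mul] at h
  · unfold besselJ0Deriv besselJ0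
    linear_combination (2 / π) * h
  all_goals exact Continuous.intervalIntegrable (by fun_prop) _ _

theorem continuous_besselJ0 : Continuous besselJ0 :=
  continuous_iff_continuousAt.2 fun t => (hasDerivAt_besselJ0 t).continuousAt

theorem abs_besselJ0_le_one (t : ℝ) : |besselJ0 t| ≤ 1 := by
  unfold besselJ0
  have h := intervalIntegral.norm_integral_le_of_norm_le_const (a := 0) (b := π / 2) (C := 1)
    (f := fun φ => Real.cos (t * Real.cos φ)) (fun x _ => Real.abs_cos_le_one _)
  rw [sub_zero, abs_of_pos (by positivity), Real.norm_eq_abs] at h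
  rw [abs_mul, abs_of_pos (by positivity)]
  calc _ ≤ 2 / π * (1 * (π / 2)) := by gcongr
    _ = 1 := by field_simp

theorem besselJ0_neg (t : ℝ) : besselJ0 (-t) = besselJ0 t := by
  simp [besselJ0]

/-- The decay `|J₀(t)| ≤ C t^{-1/2}`, from monotonicity of the energy of `√t J₀(t)`. -/
theorem exists_mul_sq_besselJ0_le : ∃ C : ℝ, 0 < C ∧ ∀ t, 1 ≤ t → t * besselJ0 t ^ 2 ≤ C := by
  -- With `u = √t J₀(t)`, Bessel's equation reads `u'' + (1 + 1/(4t²)) u = 0`. This is the energy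
  -- `u'² + (1 + 1/(4t²)) u²`, which decreases because the potential does.
  let E : ℝ → ℝ := fun t => t * besselJ0 t ^ 2 + t * besselJ0Deriv t ^ 2 +
    besselJ0 t * besselJ0Deriv t + besselJ0 t ^ 2 / (2 * t)
  have hd : ∀ t, 0 < t → HasDerivAt E (-(besselJ0 t ^ 2 / (2 * t ^ 2))) t := by
    intro t ht
    have h0 := hasDerivAt_besselJ0 t
    have h1 := hasDerivAt_besselJ0Deriv t
    have ho := besselJ0_ode t
    set J2 := (2 / π * ∫ φ in (0 : ℝ)..(π / 2), -(Real.cos φ ^ 2 * Real.cos (t * Real.cos φ)))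
    have hi := hasDerivAt_id t
    have := (((hi.mul (h0.pow 2)).add (hi.mul (h1.pow 2))).add (h0.mul h1)).add
      ((h0.pow 2).div (hi.const_mul 2) (by simp; positivity))
    convert! this using 1
    have h2 : J2 = -(besselJ0Deriv t + t * besselJ0 t) / t := by
      field_simp; linarith
    rw [h2]
    simp only [id, Pi.pow_apply]
    field_simp
    ring
  have hanti : AntitoneOn E (Ici 1) := by
    refine antitoneOn_of_deriv_nonpos (convex_Ici 1) ?_ ?_ ?_
    · intro t ht
      exact (hd t (by linarith [mem_Ici.1 ht])).continuousAt.continuousWithinAt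
    · intro t ht
      rw [interior_Ici] at ht
      exact (hd t (by linarith [mem_Ioi.1 ht])).differentiableAt.differentiableWithinAt
    · intro t ht
      rw [interior_Ici] at ht
      rw [(hd t (by linarith [mem_Ioi.1 ht])).deriv]
      have : 0 ≤ besselJ0 t ^ 2 / (2 * t ^ 2) := by positivity
      linarith
  have hlow : ∀ t, 1 ≤ t → t * besselJ0 t ^ 2 ≤ E t := by
    intro t ht
    have h0 : 0 < t := by linarith
    have : E t - t * besselJ0 t ^ 2 =
        ((2 * t * besselJ0Deriv t + besselJ0 t) ^ 2 + besselJ0 t ^ 2) / (4 * t) := by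
      simp only [E]; field_simp; ring
    have h2 : 0 ≤ E t - t * besselJ0 t ^ 2 := by rw [this]; positivity
    linarith
  refine ⟨|E 1| + 1, by positivity, fun t ht => ?_⟩
  have := hanti (mem_Ici.2 le_rfl) (mem_Ici.2 ht) ht
  linarith [hlow t ht, le_abs_self (E 1)]

/-! ### Absolute convergence, continuity and oddness of `p₅`. -/

/-- An integrable function dominating `kluyverIntegrand5 x`, up to the factor `|x|`. -/
theorem exists_kluyver_bound : ∃ g : ℝ → ℝ, IntegrableOn g (Ioi 0) ∧
    ∀ x, ∀ t ∈ Ioi (0 : ℝ), |kluyverIntegrand5 x t| ≤ |x| * g t := by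
  obtain ⟨C, hC, h⟩ := exists_mul_sq_besselJ0_le
  refine ⟨fun t => |besselJ0 t| ^ 5 * t, ?_, ?_⟩
  · have hc : Continuous fun t => |besselJ0 t| ^ 5 * t := by
      have := continuous_besselJ0; fun_prop
    rw [← Ioc_union_Ioi_eq_Ioi zero_le_one]
    refine IntegrableOn.union (hc.integrableOn_Ioc) ?_
    have hi : IntegrableOn (fun t : ℝ => (√C) ^ 5 * t ^ (-(3 / 2) : ℝ)) (Ioi 1) :=
      (integrableOn_Ioi_rpow_of_lt (by norm_num) zero_lt_one).const_mul _
    refine Integrable.mono' hi hc.aestronglyMeasurable ?_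
    refine (ae_restrict_iff' measurableSet_Ioi).2 (Eventually.of_forall fun t ht => ?_)
    have ht1 : (1 : ℝ) < t := ht
    have ht0 : (0 : ℝ) < t := by linarith
    have h1 : |besselJ0 t| ≤ √C * t ^ (-(1 / 2) : ℝ) := by
      have : |besselJ0 t| * √t ≤ √C := by
        rw [← Real.sqrt_sq_eq_abs, ← Real.sqrt_mul (sq_nonneg _)]
        exact Real.sqrt_le_sqrt (by linarith [h t ht1.le])
      rw [Real.rpow_neg ht0.le, ← Real.sqrt_eq_rpow, ← div_eq_mul_inv]
      rwa [le_div_iff₀ (by positivity)]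
    rw [Real.norm_of_nonneg (by positivity)]
    calc |besselJ0 t| ^ 5 * t ≤ (√C * t ^ (-(1 / 2) : ℝ)) ^ 5 * t := by gcongr
      _ = (√C) ^ 5 * t ^ (-(3 / 2) : ℝ) := by
        rw [mul_pow, ← Real.rpow_natCast (t ^ (-(1 / 2) : ℝ)), ← Real.rpow_mul ht0.le, mul_assoc]
        congr 1
        nth_rewrite 2 [← Real.rpow_one t]
        rw [← Real.rpow_add ht0]
        norm_num
  · intro x t ht
    have ht0 : (0 : ℝ) < t := ht
    unfold kluyverIntegrand5
    rw [abs_mul, abs_mul, abs_mul, abs_pow, abs_of_pos ht0]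
    calc _ ≤ 1 * |besselJ0 t| ^ 5 * (|x| * t) := by gcongr; exact abs_besselJ0_le_one _
      _ = _ := by ring

theorem continuous_kluyverIntegrand5 (x : ℝ) : Continuous (kluyverIntegrand5 x) := by
  have := continuous_besselJ0
  unfold kluyverIntegrand5
  fun_prop

theorem integrableOn_kluyverIntegrand5 (x : ℝ) :
    IntegrableOn (kluyverIntegrand5 x) (Ioi 0) := by
  obtain ⟨g, hg, h⟩ := exists_kluyver_bound
  refine Integrable.mono' (hg.const_mul |x|) (continuous_kluyverIntegrand5 x).aestronglyMeasurable ?_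
  exact (ae_restrict_iff' measurableSet_Ioi).2 (Eventually.of_forall fun t ht => h x t ht)

theorem continuous_kluyverP5 : Continuous kluyverP5 := by
  obtain ⟨g, hg, h⟩ := exists_kluyver_bound
  rw [continuous_iff_continuousAt]
  intro x
  unfold kluyverP5
  refine continuousAt_of_dominated (bound := fun t => (|x| + 1) * |g t|) ?_ ?_ ?_ ?_
  · exact Eventually.of_forall fun y => (continuous_kluyverIntegrand5 y).aestronglyMeasurable
  · have hx : |x| < |x| + 1 := lt_add_one _
    have : ∀ᶠ y in 𝓝 x, |y| < |x| + 1 :=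
      (isOpen_lt continuous_abs continuous_const).mem_nhds hx
    filter_upwards [this] with y hy
    refine (ae_restrict_iff' measurableSet_Ioi).2 (Eventually.of_forall fun t ht => ?_)
    calc _ ≤ |y| * g t := h y t ht
      _ ≤ |y| * |g t| := by gcongr; exact le_abs_self (g t)
      _ ≤ (|x| + 1) * |g t| := by gcongr
  · exact hg.abs.const_mul _
  · refine Eventually.of_forall fun t => ?_
    have := continuous_besselJ0
    unfold kluyverIntegrand5
    fun_prop

/-- Extends the expansion found for `x ≥ 0` to a two-sided neighbourhood of `0`, so that analyticity
at `0` can be used. -/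
theorem kluyverP5_neg (x : ℝ) : kluyverP5 (-x) = -kluyverP5 x := by
  unfold kluyverP5
  rw [← integral_neg]
  congr 1
  ext t
  simp [kluyverIntegrand5, besselJ0_neg]

/-! ### Bessel and Hankel functions of a complex variable. -/

/-- The Bessel function `J₀` as an entire function. -/
noncomputable def besselJC (z : ℂ) : ℂ :=
  2 / Real.pi * ∫ φ in (0 : ℝ)..(Real.pi / 2), Complex.cos (z * (Real.cos φ : ℂ))

/-- The modified Bessel function `I₀`. -/
noncomputable def besselI0 (s : ℝ) : ℝ :=
  2 / Real.pi * ∫ φ in (0 : ℝ)..(Real.pi / 2), Real.cosh (s * Real.cos φ)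

/-- The modified Bessel function `K₀`. -/
noncomputable def besselK0 (s : ℝ) : ℝ :=
  ∫ b in Ioi (0 : ℝ), Real.exp (-(s * Real.cosh b))

/-- The Hankel function `H₀⁽¹⁾`, as a Sommerfeld integral over the path
`i∞ - η → -η → η → η - i∞`. -/
noncomputable def hankel (η : ℝ) (z : ℂ) : ℂ :=
  2 / Real.pi * ((∫ a in (0 : ℝ)..η, Complex.exp (Complex.I * z * Complex.cos a)) -
    Complex.I * ∫ b in Ioi (0 : ℝ),
      Complex.exp (Complex.I * z * Complex.cos (η - b * Complex.I)))

theorem Complex.norm_cos_le_exp (z : ℂ) : ‖Complex.cos z‖ ≤ Real.exp |z.im| := by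
  rw [Complex.cos, norm_div, Complex.norm_ofNat]
  have h1 : ‖Complex.exp (z * Complex.I)‖ ≤ Real.exp |z.im| := by
    rw [Complex.norm_exp]; simpa using neg_le_abs z.im
  have h2 : ‖Complex.exp (-z * Complex.I)‖ ≤ Real.exp |z.im| := by
    rw [Complex.norm_exp]; simpa using le_abs_self z.im
  linarith [norm_add_le (Complex.exp (z * Complex.I)) (Complex.exp (-z * Complex.I))]

theorem Complex.norm_sin_le_exp (z : ℂ) : ‖Complex.sin z‖ ≤ Real.exp |z.im| := by
  have := Complex.norm_cos_le_exp (z - π / 2)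
  rw [Complex.cos_sub_pi_div_two] at this
  simpa using this

theorem besselJC_ofReal (t : ℝ) : besselJC t = besselJ0 t := by
  unfold besselJC besselJ0
  push_cast
  rw [← intervalIntegral.integral_ofReal]
  simp

theorem besselJC_ofReal_mul_I (s : ℝ) : besselJC (s * Complex.I) = besselI0 s := by
  unfold besselJC besselI0
  push_cast
  rw [← intervalIntegral.integral_ofReal]
  congr 2
  ext φ
  rw [mul_right_comm, Complex.cos_mul_I]
  push_cast
  rfl

theorem norm_besselJC_le (z : ℂ) : ‖besselJC z‖ ≤ Real.exp |z.im| := by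
  unfold besselJC
  have h := intervalIntegral.norm_integral_le_of_norm_le_const (a := 0) (b := π / 2)
    (C := Real.exp |z.im|) (f := fun φ : ℝ => Complex.cos (z * (Real.cos φ : ℂ))) (fun x _ => by
      refine (Complex.norm_cos_le_exp _).trans (Real.exp_le_exp.2 ?_)
      rw [Complex.im_mul_ofReal, abs_mul]
      exact mul_le_of_le_one_right (abs_nonneg _) (Real.abs_cos_le_one _))
  rw [sub_zero, abs_of_pos pi_div_two_pos] at h
  have h2 : ‖(2 / π : ℂ)‖ = 2 / π := by simp [abs_of_pos Real.pi_pos]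
  rw [norm_mul, h2]
  calc _ ≤ 2 / π * (Real.exp |z.im| * (π / 2)) := by gcongr
    _ = _ := by field_simp

theorem differentiable_besselJC : Differentiable ℂ besselJC := by
  intro z
  have h := (intervalIntegral.hasDerivAt_integral_of_dominated_loc_of_deriv_le
    (μ := volume) (a := 0) (b := π / 2)
    (F := fun (z : ℂ) (φ : ℝ) => Complex.cos (z * (Real.cos φ : ℂ)))
    (F' := fun (z : ℂ) (φ : ℝ) => -Complex.sin (z * (Real.cos φ : ℂ)) * (Real.cos φ : ℂ))
    (bound := fun _ => Real.exp (‖z‖ + 1)) (x₀ := z) (Metric.ball_mem_nhds z one_pos)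
    ?_ ?_ ?_ ?_ ?_ ?_).2
  · exact (h.const_mul (2 / π : ℂ)).differentiableAt
  · exact Eventually.of_forall fun t =>
      Continuous.aestronglyMeasurable (by fun_prop)
  · exact Continuous.intervalIntegrable (by fun_prop) _ _
  · exact Continuous.aestronglyMeasurable (by fun_prop)
  · refine Eventually.of_forall fun φ _ x hx => ?_
    rw [norm_mul, norm_neg, Complex.norm_real]
    have h1 : ‖x‖ ≤ ‖z‖ + 1 := by
      have := norm_sub_norm_le x z
      rw [Metric.mem_ball, dist_eq_norm] at hx
      linarith
    have h2 : |(x * (Real.cos φ : ℂ)).im| ≤ ‖z‖ + 1 := by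
      rw [Complex.im_mul_ofReal, abs_mul]
      exact (mul_le_of_le_one_right (abs_nonneg _) (Real.abs_cos_le_one _)).trans
        ((Complex.abs_im_le_norm x).trans h1)
    calc _ ≤ ‖Complex.sin (x * (Real.cos φ : ℂ))‖ * 1 := by
          gcongr; exact Real.abs_cos_le_one _
      _ ≤ _ := by
        rw [mul_one]
        exact (Complex.norm_sin_le_exp _).trans (Real.exp_le_exp.2 h2)
  · exact intervalIntegrable_const
  · refine Eventually.of_forall fun φ _ x _ => ?_
    exact (hasDerivAt_mul_const (x := x) (Real.cos φ : ℂ)).ccos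

theorem re_I_mul_mul_cos (η b : ℝ) (z : ℂ) :
    (Complex.I * z * Complex.cos (η - b * Complex.I)).re =
      -(z.re * Real.sin η * Real.sinh b + z.im * Real.cos η * Real.cosh b) := by
  rw [Complex.cos_sub, Complex.cos_mul_I, Complex.sin_mul_I, ← Complex.ofReal_cos,
    ← Complex.ofReal_sin, ← Complex.ofReal_cosh, ← Complex.ofReal_sinh]
  simp only [Complex.mul_re, Complex.mul_im, Complex.add_re,
    Complex.add_im, Complex.ofReal_re, Complex.ofReal_im, Complex.I_re, Complex.I_im]
  ring

/-- Split `sinh b` and `cosh b` into exponentials: the `exp (-b)` part contributes at most `‖z‖` to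
the exponent, and the `exp b` part gives doubly exponential decay in the half plane where the linear
form is positive. -/
theorem norm_hankel_kernel_le (η : ℝ) {b : ℝ} (hb : 0 ≤ b) (z : ℂ) :
    ‖Complex.exp (Complex.I * z * Complex.cos (η - b * Complex.I))‖ ≤ Real.exp ‖z‖ *
      Real.exp (-((z.re * Real.sin η + z.im * Real.cos η) / 2 * Real.exp b)) := by
  rw [Complex.norm_exp, re_I_mul_mul_cos, ← Real.exp_add, Real.exp_le_exp, Real.sinh_eq,
    Real.cosh_eq]
  have h1 : |z.re * Real.sin η - z.im * Real.cos η| ≤ 2 * ‖z‖ := by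
    calc _ ≤ |z.re * Real.sin η| + |z.im * Real.cos η| := abs_sub _ _
      _ ≤ |z.re| * 1 + |z.im| * 1 := by
        rw [abs_mul, abs_mul]
        gcongr
        · exact Real.abs_sin_le_one _
        · exact Real.abs_cos_le_one _
      _ ≤ _ := by linarith [Complex.abs_re_le_norm z, Complex.abs_im_le_norm z]
  have h2 : Real.exp (-b) ≤ 1 := Real.exp_le_one_iff.2 (by linarith)
  have h3 : (z.re * Real.sin η - z.im * Real.cos η) * Real.exp (-b) ≤ 2 * ‖z‖ := by
    calc _ ≤ |z.re * Real.sin η - z.im * Real.cos η| * Real.exp (-b) := by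
          gcongr; exact le_abs_self _
      _ ≤ (2 * ‖z‖) * 1 := by gcongr
      _ = _ := mul_one _
  linarith

theorem integrableOn_exp_mul_exp_neg_mul_exp {m : ℝ} (hm : 0 < m) :
    IntegrableOn (fun b => Real.exp b * Real.exp (-(m * Real.exp b))) (Ioi 0) := by
  have hd : ∀ b : ℝ, HasDerivAt (fun b => -(1 / m) * Real.exp (-(m * Real.exp b)))
      (Real.exp b * Real.exp (-(m * Real.exp b))) b := by
    intro b
    refine ((((Real.hasDerivAt_exp b).const_mul m).neg.exp).const_mul (-(1 / m))).congr_deriv ?_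
    simp only [Pi.neg_apply]
    field_simp
  refine integrableOn_Ioi_deriv_of_nonneg' (l := -(1 / m) * 0) (fun b _ => hd b)
    (fun b _ => by positivity) ?_
  refine Tendsto.const_mul _ (Real.tendsto_exp_neg_atTop_nhds_zero.comp ?_)
  exact Real.tendsto_exp_atTop.const_mul_atTop hm

theorem integrableOn_exp_neg_mul_exp {m : ℝ} (hm : 0 < m) :
    IntegrableOn (fun b => Real.exp (-(m * Real.exp b))) (Ioi 0) := by
  refine Integrable.mono' (integrableOn_exp_mul_exp_neg_mul_exp hm)
    (Continuous.aestronglyMeasurable (by fun_prop)) ?_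
  refine (ae_restrict_iff' measurableSet_Ioi).2 (Eventually.of_forall fun b hb => ?_)
  rw [Real.norm_of_nonneg (Real.exp_nonneg _)]
  exact le_mul_of_one_le_left (Real.exp_nonneg _) (Real.one_le_exp (le_of_lt hb))

theorem norm_cos_sub_mul_I_le (η : ℝ) {b : ℝ} (hb : 0 ≤ b) :
    ‖Complex.cos (η - b * Complex.I)‖ ≤ Real.exp b := by
  refine (Complex.norm_cos_le_exp _).trans (Real.exp_le_exp.2 ?_)
  simp [abs_of_nonneg hb]

theorem continuous_hankel_kernel (η : ℝ) (z : ℂ) : Continuous fun b : ℝ =>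
    Complex.exp (Complex.I * z * Complex.cos (η - b * Complex.I)) := by fun_prop

theorem integrableOn_hankel_kernel {η : ℝ} {z : ℂ}
    (hz : 0 < z.re * Real.sin η + z.im * Real.cos η) : IntegrableOn (fun b : ℝ =>
    Complex.exp (Complex.I * z * Complex.cos (η - b * Complex.I))) (Ioi 0) := by
  refine Integrable.mono' ((integrableOn_exp_neg_mul_exp (half_pos hz)).const_mul (Real.exp ‖z‖))
    (continuous_hankel_kernel η z).aestronglyMeasurable ?_
  exact (ae_restrict_iff' measurableSet_Ioi).2 (Eventually.of_forall fun b hb =>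
    norm_hankel_kernel_le η (le_of_lt hb) z)

theorem differentiableAt_hankel {η : ℝ} {z : ℂ}
    (hz : 0 < z.re * Real.sin η + z.im * Real.cos η) : DifferentiableAt ℂ (hankel η) z := by
  have h1 : DifferentiableAt ℂ
      (fun z : ℂ => ∫ a in (0 : ℝ)..η, Complex.exp (Complex.I * z * Complex.cos a)) z := by
    refine (intervalIntegral.hasDerivAt_integral_of_dominated_loc_of_deriv_le
      (μ := volume) (a := 0) (b := η)
      (F := fun (z : ℂ) (a : ℝ) => Complex.exp (Complex.I * z * Complex.cos a))
      (F' := fun (z : ℂ) (a : ℝ) => Complex.exp (Complex.I * z * Complex.cos a) *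
        (Complex.I * Complex.cos a))
      (bound := fun _ => Real.exp (‖z‖ + 1)) (x₀ := z) (Metric.ball_mem_nhds z one_pos)
      ?_ ?_ ?_ ?_ ?_ ?_).2.differentiableAt
    · exact Eventually.of_forall fun t =>
        Continuous.aestronglyMeasurable (by fun_prop)
    · exact Continuous.intervalIntegrable (by fun_prop) _ _
    · exact Continuous.aestronglyMeasurable (by fun_prop)
    · refine Eventually.of_forall fun a _ x hx => ?_
      have h1 : ‖x‖ ≤ ‖z‖ + 1 := by
        have := norm_sub_norm_le x z
        rw [Metric.mem_ball, dist_eq_norm] at hx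
        linarith
      have h2 : ‖Complex.cos (a : ℂ)‖ ≤ 1 := by
        rw [← Complex.ofReal_cos, Complex.norm_real]; exact Real.abs_cos_le_one _
      rw [norm_mul, norm_mul, Complex.norm_I, one_mul]
      have h3 : ‖Complex.exp (Complex.I * x * Complex.cos a)‖ ≤ Real.exp (‖z‖ + 1) := by
        refine (Complex.norm_exp_le_exp_norm _).trans (Real.exp_le_exp.2 ?_)
        rw [norm_mul, norm_mul, Complex.norm_I, one_mul]
        exact (mul_le_of_le_one_right (norm_nonneg _) h2).trans h1
      calc _ ≤ Real.exp (‖z‖ + 1) * 1 := by gcongr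
        _ = _ := mul_one _
    · exact intervalIntegrable_const
    · refine Eventually.of_forall fun a _ x _ => ?_
      refine (((hasDerivAt_id x).const_mul Complex.I).mul_const (Complex.cos a)).cexp.congr_deriv ?_
      simp
  have h2 : DifferentiableAt ℂ (fun z : ℂ => ∫ b in Ioi (0 : ℝ),
      Complex.exp (Complex.I * z * Complex.cos (η - b * Complex.I))) z := by
    set σ := z.re * Real.sin η + z.im * Real.cos η with hσ
    have hs : {x : ℂ | σ / 2 < x.re * Real.sin η + x.im * Real.cos η} ∩ Metric.ball z 1 ∈ 𝓝 z := by
      refine inter_mem ?_ (Metric.ball_mem_nhds z one_pos)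
      refine IsOpen.mem_nhds (isOpen_lt continuous_const (by fun_prop)) ?_
      change σ / 2 < σ
      linarith
    have h4 : 0 < σ / 4 := by linarith
    refine (hasDerivAt_integral_of_dominated_loc_of_deriv_le
      (μ := volume.restrict (Ioi 0)) (x₀ := z) (𝕜 := ℂ)
      (F := fun (z : ℂ) (b : ℝ) =>
        Complex.exp (Complex.I * z * Complex.cos (η - b * Complex.I)))
      (F' := fun (z : ℂ) (b : ℝ) =>
        Complex.exp (Complex.I * z * Complex.cos (η - b * Complex.I)) *
        (Complex.I * Complex.cos (η - b * Complex.I)))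
      (bound := fun b => Real.exp (‖z‖ + 1) * (Real.exp b * Real.exp (-(σ / 4 * Real.exp b)))) hs
      ?_ ?_ ?_ ?_ ?_ ?_).2.differentiableAt
    · exact Eventually.of_forall fun t => (continuous_hankel_kernel η t).aestronglyMeasurable
    · exact integrableOn_hankel_kernel hz
    · exact Continuous.aestronglyMeasurable (by fun_prop)
    · refine (ae_restrict_iff' measurableSet_Ioi).2 (Eventually.of_forall fun b hb x hx => ?_)
      have hb0 : 0 ≤ b := le_of_lt hb
      have h1 : ‖x‖ ≤ ‖z‖ + 1 := by
        have := norm_sub_norm_le x z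
        have hx := hx.2
        rw [Metric.mem_ball, dist_eq_norm] at hx
        linarith
      have hx1 : σ / 4 ≤ (x.re * Real.sin η + x.im * Real.cos η) / 2 := by
        have : σ / 2 < x.re * Real.sin η + x.im * Real.cos η := hx.1
        linarith
      rw [norm_mul, norm_mul, Complex.norm_I, one_mul]
      calc _ ≤ (Real.exp ‖x‖ * Real.exp (-((x.re * Real.sin η + x.im * Real.cos η) / 2
            * Real.exp b))) * Real.exp b := by
            gcongr
            · exact norm_hankel_kernel_le η hb0 x
            · exact norm_cos_sub_mul_I_le η hb0
        _ ≤ (Real.exp (‖z‖ + 1) * Real.exp (-(σ / 4 * Real.exp b))) * Real.exp b := by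
            gcongr
        _ = _ := by ring
    · exact (integrableOn_exp_mul_exp_neg_mul_exp h4).const_mul _
    · refine Eventually.of_forall fun b x _ => ?_
      refine (((hasDerivAt_id x).const_mul Complex.I).mul_const
        (Complex.cos (η - b * Complex.I))).cexp.congr_deriv ?_
      simp
  exact (h1.sub (h2.const_mul Complex.I)).const_mul (2 / π : ℂ)

/-- The Sommerfeld integral does not depend on the path. -/
theorem hankel_eq_hankel {η₁ η₂ m : ℝ} (hη : η₁ ≤ η₂) (hm : 0 < m) {z : ℂ}
    (hz : ∀ a ∈ Icc η₁ η₂, m ≤ z.re * Real.sin a + z.im * Real.cos a) :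
    hankel η₁ z = hankel η₂ z := by
  set f : ℂ → ℂ := fun w => Complex.exp (Complex.I * z * Complex.cos w) with hf
  have hfc : Continuous f := by fun_prop
  have hi : ∀ a b : ℝ, IntervalIntegrable (fun x : ℝ => f x) volume a b := fun a b =>
    (hfc.comp Complex.continuous_ofReal).intervalIntegrable a b
  -- Cauchy's theorem on the rectangle with opposite corners `η₁` and `η₂ - iT`; its lower side is
  -- shown next to vanish as `T → ∞`.
  have hrect : ∀ T : ℝ, (∫ a in η₁..η₂, f a) - Complex.I * (∫ b in (0 : ℝ)..T, f (η₂ - b * Complex.I))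
      + Complex.I * (∫ b in (0 : ℝ)..T, f (η₁ - b * Complex.I)) =
      ∫ a in η₁..η₂, f (a - T * Complex.I) := by
    intro T
    have h := Complex.integral_boundary_rect_eq_zero_of_differentiableOn f η₁ (η₂ + (-T : ℝ) * Complex.I)
      (Differentiable.differentiableOn (by fun_prop))
    have hneg : ∀ η : ℝ, ∫ y in (0 : ℝ)..(-T), f (η + y * Complex.I) =
        -∫ b in (0 : ℝ)..T, f (η - b * Complex.I) := by
      intro η
      have := intervalIntegral.integral_comp_neg (a := 0) (b := T)
        (fun y : ℝ => f (η + y * Complex.I))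
      rw [neg_zero] at this
      rw [intervalIntegral.integral_symm, ← this]
      congr 2
      ext b
      push_cast
      ring_nf
    simp only [Complex.ofReal_re, Complex.ofReal_im, Complex.add_re, Complex.add_im,
      Complex.mul_re, Complex.mul_im, Complex.I_re, Complex.I_im, mul_zero, mul_one, zero_mul,
      sub_zero, add_zero, zero_add, smul_eq_mul, Complex.ofReal_zero, hneg] at h
    have h' : ∫ x in η₁..η₂, f (x + (-T : ℝ) * Complex.I) =
        ∫ a in η₁..η₂, f (a - T * Complex.I) := by
      congr 1; ext a; push_cast; ring_nf
    rw [h'] at h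
    linear_combination h
  have hlim : Tendsto (fun T : ℝ => ∫ a in η₁..η₂, f (a - T * Complex.I)) atTop (𝓝 0) := by
    have hb : Tendsto (fun T : ℝ => Real.exp ‖z‖ * Real.exp (-(m / 2 * Real.exp T)) * |η₂ - η₁|)
        atTop (𝓝 (Real.exp ‖z‖ * 0 * |η₂ - η₁|)) := by
      refine Tendsto.mul_const _ (Tendsto.const_mul _ (Real.tendsto_exp_neg_atTop_nhds_zero.comp ?_))
      exact Real.tendsto_exp_atTop.const_mul_atTop (half_pos hm)
    rw [mul_zero, zero_mul] at hb
    refine squeeze_zero_norm' ?_ hb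
    filter_upwards [eventually_ge_atTop 0] with T hT
    refine intervalIntegral.norm_integral_le_of_norm_le_const fun a ha => ?_
    rw [uIoc_of_le hη] at ha
    refine (norm_hankel_kernel_le a hT z).trans ?_
    have := hz a ⟨ha.1.le, ha.2⟩
    gcongr
  have hσ₁ : IntegrableOn (fun b : ℝ => f (η₁ - b * Complex.I)) (Ioi 0) :=
    integrableOn_hankel_kernel (hm.trans_le (hz η₁ ⟨le_rfl, hη⟩))
  have hσ₂ : IntegrableOn (fun b : ℝ => f (η₂ - b * Complex.I)) (Ioi 0) :=
    integrableOn_hankel_kernel (hm.trans_le (hz η₂ ⟨hη, le_rfl⟩))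
  have h1 := intervalIntegral_tendsto_integral_Ioi 0 hσ₁ tendsto_id
  have h2 := intervalIntegral_tendsto_integral_Ioi 0 hσ₂ tendsto_id
  have h3 := ((tendsto_const_nhds (x := ∫ a in η₁..η₂, f a)).sub (h2.const_mul Complex.I)).add
    (h1.const_mul Complex.I)
  have h4 := tendsto_nhds_unique (h3.congr hrect) hlim
  have h5 := intervalIntegral.integral_add_adjacent_intervals (hi 0 η₁) (hi η₁ η₂)
  have e1 : hankel η₁ z = 2 / π * ((∫ a in (0 : ℝ)..η₁, f a) -
    Complex.I * ∫ b in Ioi (0 : ℝ), f (η₁ - b * Complex.I)) := rfl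
  have e2 : hankel η₂ z = 2 / π * ((∫ a in (0 : ℝ)..η₂, f a) -
    Complex.I * ∫ b in Ioi (0 : ℝ), f (η₂ - b * Complex.I)) := rfl
  rw [e1, e2, ← h5]
  linear_combination (-(2 / π : ℂ)) * h4

/-- Move the corner of the path to `π/2`. The kernel on the vertical ray is then the real number
`exp (-t sinh b)`, so that ray contributes only to the imaginary part, and the horizontal segment
gives `J₀`. -/
theorem re_hankel_ofReal {η t : ℝ} (h0 : 0 < η) (h1 : η ≤ π / 2) (ht : 0 < t) :
    (hankel η t).re = besselJ0 t := by
  have hs : 0 < Real.sin η := Real.sin_pos_of_pos_of_lt_pi h0 (by linarith [Real.pi_pos])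
  rw [hankel_eq_hankel h1 (mul_pos ht hs)]
  · have e1 : ∀ b : ℝ, Complex.exp (Complex.I * t *
        Complex.cos ((π / 2 : ℝ) - b * Complex.I)) = (Real.exp (-(t * Real.sinh b)) : ℝ) := by
      intro b
      push_cast
      rw [Complex.cos_pi_div_two_sub, Complex.sin_mul_I]
      congr 1
      linear_combination (t * Complex.sinh b) * Complex.I_sq
    have e2 : (∫ a in (0 : ℝ)..(π / 2), Complex.exp (Complex.I * t * Complex.cos a)).re =
        ∫ a in (0 : ℝ)..(π / 2), Real.cos (t * Real.cos a) := by
      have := intervalIntegral.intervalIntegral_re (𝕜 := ℂ) (a := 0) (b := π / 2) (μ := volume)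
        (f := fun a : ℝ => Complex.exp (Complex.I * t * Complex.cos a))
        (Continuous.intervalIntegrable (by fun_prop) _ _)
      refine this.symm.trans ?_
      congr 1
      ext a
      rw [← Complex.exp_ofReal_mul_I_re (t * Real.cos a)]
      push_cast
      change (Complex.exp _).re = _
      ring_nf
    unfold hankel besselJ0
    simp_rw [e1]
    rw [integral_complex_ofReal]
    have : (2 / π : ℂ) = ((2 / π : ℝ) : ℂ) := by push_cast; rfl
    rw [this, Complex.re_ofReal_mul, Complex.sub_re, e2]
    simp
  · intro a ha
    simp only [Complex.ofReal_re, Complex.ofReal_im, zero_mul, add_zero]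
    gcongr
    exact Real.sin_le_sin_of_le_of_le_pi_div_two (by linarith [Real.pi_pos]) ha.2 ha.1

/-- Move the corner to `0`: the horizontal segment disappears and the vertical ray is the integral
defining `K₀`. -/
theorem hankel_ofReal_mul_I {η s : ℝ} (h0 : 0 ≤ η) (h1 : η < π / 2) (hs : 0 < s) :
    hankel η (s * Complex.I) = -(2 / π * besselK0 s : ℝ) * Complex.I := by
  have hc : 0 < Real.cos η := Real.cos_pos_of_mem_Ioo ⟨by linarith [Real.pi_pos], h1⟩
  rw [← hankel_eq_hankel h0 (mul_pos hs hc)]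
  · have e1 : ∀ b : ℝ, Complex.exp (Complex.I * (s * Complex.I) *
        Complex.cos ((0 : ℝ) - b * Complex.I)) = (Real.exp (-(s * Real.cosh b)) : ℝ) := by
      intro b
      push_cast
      rw [zero_sub, Complex.cos_neg, Complex.cos_mul_I]
      congr 1
      linear_combination (s * Complex.cosh b) * Complex.I_sq
    unfold hankel besselK0
    simp_rw [e1]
    rw [integral_complex_ofReal]
    push_cast
    simp
    ring
  · intro a ha
    simp only [Complex.mul_re, Complex.mul_im, Complex.ofReal_re, Complex.ofReal_im, Complex.I_re,
      Complex.I_im, mul_zero, zero_mul, mul_one, sub_zero, zero_add, add_zero]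
    gcongr
    exact Real.cos_le_cos_of_nonneg_of_le_pi ha.1 (by linarith) ha.2

/-- From `exp (-q) ≤ 1/(1 + q) ≤ (1 + q)^(-1/8)`. The logarithmic singularity at `r = 0` is traded
for a power; with exponent `1/8` even a fifth power stays integrable at `0`. -/
theorem exp_neg_mul_sinh_le {m : ℝ} (hm : 0 < m) : ∃ C : ℝ, 0 < C ∧ ∀ r b : ℝ, 0 < r → 0 ≤ b →
    Real.exp (-(m * r * Real.sinh b)) ≤ C * (1 + r ^ (-(1 / 8) : ℝ)) * Real.exp (-b / 8) := by
  refine ⟨(1 / 2 : ℝ) ^ (-(1 / 8) : ℝ) + (m / 2) ^ (-(1 / 8) : ℝ), by positivity,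
    fun r b hr hb => ?_⟩
  have hsinh : Real.exp b / 2 ≤ 1 + Real.sinh b := by
    rw [Real.sinh_eq]
    have : Real.exp (-b) ≤ 1 := Real.exp_le_one_iff.2 (by linarith)
    linarith
  have hsn : 0 ≤ Real.sinh b := Real.sinh_nonneg_iff.2 hb
  set q := m * r * Real.sinh b with hq
  have hq0 : 0 ≤ q := by positivity
  have h1 : Real.exp (-q) ≤ (1 + q) ^ (-(1 / 8) : ℝ) := by
    have h2 : Real.exp (-q) ≤ (1 + q) ^ (-1 : ℝ) := by
      rw [Real.exp_neg, Real.rpow_neg_one]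
      gcongr
      linarith [Real.add_one_le_exp q]
    exact h2.trans (Real.rpow_le_rpow_of_exponent_le (by linarith) (by norm_num))
  have he : Real.exp (-b / 8) = (Real.exp b) ^ (-(1 / 8) : ℝ) := by
    rw [← Real.exp_mul]; congr 1; ring
  have hA : 0 ≤ (1 / 2 : ℝ) ^ (-(1 / 8) : ℝ) := by positivity
  have hB : 0 ≤ (m / 2) ^ (-(1 / 8) : ℝ) := by positivity
  have hr8 : 0 ≤ r ^ (-(1 / 8) : ℝ) := by positivity
  have hE : 0 ≤ Real.exp (-b / 8) := by positivity
  refine h1.trans ?_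
  rcases le_total 1 (m * r) with h | h
  · have h3 : 1 / 2 * Real.exp b ≤ 1 + q := by
      have : Real.sinh b ≤ q := le_mul_of_one_le_left hsn h
      linarith
    have := Real.rpow_le_rpow_of_nonpos (z := -(1 / 8)) (by positivity) h3 (by norm_num)
    rw [Real.mul_rpow (by norm_num) (by positivity), ← he] at this
    refine this.trans ?_
    gcongr
    nlinarith [mul_nonneg hA hr8, mul_nonneg hB hr8]
  · have h3 : m / 2 * r * Real.exp b ≤ 1 + q := by
      have : m * r * (Real.exp b / 2) ≤ m * r * (1 + Real.sinh b) := by gcongr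
      linarith
    have := Real.rpow_le_rpow_of_nonpos (z := -(1 / 8)) (by positivity) h3 (by norm_num)
    rw [Real.mul_rpow (by positivity) (by positivity), Real.mul_rpow (by positivity) hr.le,
      ← he] at this
    refine this.trans ?_
    gcongr
    · linarith
    · linarith

/-- Of the vertical decay rate `cos η`, the part `κ` is kept as the factor `exp (-κ Im z)`. The
surplus `cos η - κ`, together with `sin η` in the real direction, makes the integral over the
infinite ray converge uniformly. -/
theorem exists_norm_hankel_le {η κ : ℝ} (h0 : 0 < η) (h1 : η < π / 2) (hκ0 : 0 ≤ κ)
    (hκ : κ < Real.cos η) : ∃ C : ℝ, 0 < C ∧ ∀ z : ℂ, z ≠ 0 → 0 ≤ z.re → 0 ≤ z.im →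
      ‖hankel η z‖ ≤ C * (1 + ‖z‖ ^ (-(1 / 8) : ℝ)) * Real.exp (-(κ * z.im)) := by
  have hs : 0 < Real.sin η := Real.sin_pos_of_pos_of_lt_pi h0 (by linarith [Real.pi_pos])
  set m := min (Real.cos η - κ) (Real.sin η) with hm
  have hm0 : 0 < m := lt_min (by linarith) hs
  have hm1 : m ≤ Real.cos η - κ := min_le_left _ _
  have hm2 : m ≤ Real.sin η := min_le_right _ _
  obtain ⟨C, hC, hb⟩ := exp_neg_mul_sinh_le hm0
  refine ⟨2 / π * (η + C * 8), by positivity, fun z hz hre him => ?_⟩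
  have hr : 0 < ‖z‖ := norm_pos_iff.2 hz
  set u := 1 + ‖z‖ ^ (-(1 / 8) : ℝ) with hu
  have hu1 : 1 ≤ u := by
    have : 0 ≤ ‖z‖ ^ (-(1 / 8) : ℝ) := by positivity
    linarith
  have n1 : ‖∫ a in (0 : ℝ)..η, Complex.exp (Complex.I * z * Complex.cos a)‖ ≤
      Real.exp (-(κ * z.im)) * |η - 0| := by
    refine intervalIntegral.norm_integral_le_of_norm_le_const fun a ha => ?_
    rw [uIoc_of_le h0.le] at ha
    have := re_I_mul_mul_cos a 0 z
    simp only [Complex.ofReal_zero, zero_mul, sub_zero, Real.sinh_zero, mul_zero, Real.cosh_zero,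
      zero_add, mul_one] at this
    rw [Complex.norm_exp, this, Real.exp_le_exp, neg_le_neg_iff, mul_comm]
    gcongr
    exact hκ.le.trans (Real.cos_le_cos_of_nonneg_of_le_pi ha.1.le (by linarith) ha.2)
  have n2 : ‖∫ b in Ioi (0 : ℝ), Complex.exp (Complex.I * z * Complex.cos (η - b * Complex.I))‖ ≤
      ∫ b in Ioi (0 : ℝ), Real.exp (-(κ * z.im)) * (C * u) * Real.exp (-(1 / 8) * b) := by
    refine norm_integral_le_of_norm_le ((exp_neg_integrableOn_Ioi 0 (by norm_num)).const_mul _) ?_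
    refine (ae_restrict_iff' measurableSet_Ioi).2 (Eventually.of_forall fun b hb0 => ?_)
    have hb0' : 0 ≤ b := le_of_lt hb0
    rw [Complex.norm_exp, re_I_mul_mul_cos]
    have hsn : 0 ≤ Real.sinh b := Real.sinh_nonneg_iff.2 hb0'
    have hch : 1 ≤ Real.cosh b := Real.one_le_cosh b
    have hsc : Real.sinh b ≤ Real.cosh b := (Real.sinh_lt_cosh b).le
    have hnorm : ‖z‖ ≤ z.re + z.im := by
      have := Complex.norm_le_abs_re_add_abs_im z
      rwa [abs_of_nonneg hre, abs_of_nonneg him] at this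
    have key : κ * z.im + m * ‖z‖ * Real.sinh b ≤
        z.re * Real.sin η * Real.sinh b + z.im * Real.cos η * Real.cosh b := by
      have a1 : κ * z.im * 1 ≤ κ * z.im * Real.cosh b := by gcongr
      have a2 : m * z.im * Real.sinh b ≤ (Real.cos η - κ) * z.im * Real.cosh b := by gcongr
      have a3 : m * z.re * Real.sinh b ≤ Real.sin η * z.re * Real.sinh b := by gcongr
      have a4 : m * ‖z‖ * Real.sinh b ≤ m * (z.re + z.im) * Real.sinh b := by gcongr
      linarith
    calc _ ≤ Real.exp (-(κ * z.im)) * Real.exp (-(m * ‖z‖ * Real.sinh b)) := by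
          rw [← Real.exp_add, Real.exp_le_exp]; linarith
      _ ≤ Real.exp (-(κ * z.im)) * (C * u * Real.exp (-b / 8)) := by
          gcongr; exact hb _ _ hr hb0'
      _ = _ := by rw [mul_assoc, show -b / 8 = -(1 / 8) * b by ring]; ring
  rw [integral_const_mul, integral_exp_mul_Ioi (by norm_num)] at n2
  rw [sub_zero, abs_of_pos h0] at n1
  have h2 : ‖(2 / π : ℂ)‖ = 2 / π := by simp [abs_of_pos Real.pi_pos]
  unfold hankel
  rw [norm_mul, h2]
  have hE := Real.exp_pos (-(κ * z.im))
  set E := Real.exp (-(κ * z.im))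
  calc _ ≤ 2 / π * (E * η + E * (C * u) * 8) := by
        gcongr
        refine (norm_sub_le _ _).trans (add_le_add n1 ?_)
        rw [norm_mul, Complex.norm_I, one_mul]
        refine n2.trans (le_of_eq ?_)
        simp
    _ ≤ 2 / π * (E * (η * u) + E * (C * u) * 8) := by
        gcongr; exact le_mul_of_one_le_right h0.le hu1
    _ = _ := by ring

/-! ### Rotating the ray of integration by a right angle. -/

theorem one_add_mul_exp_neg_le {ε : ℝ} (hε : 0 < ε) {t : ℝ} (ht : 0 ≤ t) :
    (1 + t) * Real.exp (-(ε * t)) ≤ (1 + 2 / ε) * Real.exp (-(ε / 2) * t) := by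
  have h1 : 1 + t ≤ (1 + 2 / ε) * Real.exp (ε / 2 * t) := by
    have h2 := Real.add_one_le_exp (ε / 2 * t)
    have h3 : 1 + t ≤ (1 + 2 / ε) * (ε / 2 * t + 1) := by
      have : (1 + 2 / ε) * (ε / 2 * t + 1) = 1 + t + (2 / ε + ε / 2 * t) := by field_simp; ring
      rw [this]
      have : 0 ≤ 2 / ε + ε / 2 * t := by positivity
      linarith
    exact h3.trans (by gcongr)
  calc _ ≤ ((1 + 2 / ε) * Real.exp (ε / 2 * t)) * Real.exp (-(ε * t)) := by gcongr
    _ = _ := by rw [mul_assoc, ← Real.exp_add]; congr 2; ring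

theorem integrableOn_one_add_mul_exp_neg {ε : ℝ} (hε : 0 < ε) :
    IntegrableOn (fun t => (1 + t) * Real.exp (-(ε * t))) (Ioi 0) := by
  refine Integrable.mono' ((exp_neg_integrableOn_Ioi 0 (half_pos hε)).const_mul (1 + 2 / ε))
    (Continuous.aestronglyMeasurable (by fun_prop)) ?_
  refine (ae_restrict_iff' measurableSet_Ioi).2 (Eventually.of_forall fun t ht => ?_)
  have ht0 : (0 : ℝ) ≤ t := le_of_lt ht
  rw [Real.norm_of_nonneg (by positivity)]
  exact one_add_mul_exp_neg_le hε ht0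

theorem tendsto_one_add_mul_mul_exp_neg {ε : ℝ} (hε : 0 < ε) :
    Tendsto (fun R : ℝ => (1 + 2 * R) * Real.exp (-(ε * R)) * R) atTop (𝓝 0) := by
  have h1 := tendsto_rpow_mul_exp_neg_mul_atTop_nhds_zero 1 ε hε
  have h2 := tendsto_rpow_mul_exp_neg_mul_atTop_nhds_zero 2 ε hε
  have h := h1.add (h2.const_mul 2)
  simp only [mul_zero, add_zero] at h
  refine h.congr fun R => ?_
  rw [Real.rpow_one, Real.rpow_ofNat, neg_mul]
  ring

/-- Cauchy's theorem on the square `[0, R]²`. The top side vanishes by the decay of `f`. The bound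
on `f` has no decay along the real direction, so the damping `exp (-εz)` is needed for the right
side and for convergence on the real axis. -/
theorem integral_rotate_quadrant_aux {f : ℂ → ℂ} {C c ε : ℝ} (hC : 0 < C) (hc : 0 < c) (hε : 0 < ε)
    (hcont : ContinuousOn f {z | 0 ≤ z.re ∧ 0 ≤ z.im})
    (hd : DifferentiableOn ℂ f {z | 0 < z.re ∧ 0 < z.im})
    (hb : ∀ z : ℂ, 0 ≤ z.re → 0 ≤ z.im → ‖f z‖ ≤ C * (1 + ‖z‖) * Real.exp (-(c * z.im))) :
    ∫ t in Ioi (0 : ℝ), f t * Complex.exp (-(ε * t)) =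
      Complex.I * ∫ s in Ioi (0 : ℝ), f (s * Complex.I) * Complex.exp (-(ε * (s * Complex.I))) := by
  set g : ℂ → ℂ := fun z => f z * Complex.exp (-(ε * z)) with hg
  have hgb : ∀ z : ℂ, 0 ≤ z.re → 0 ≤ z.im →
      ‖g z‖ ≤ C * (1 + ‖z‖) * Real.exp (-(c * z.im)) * Real.exp (-(ε * z.re)) := by
    intro z h1 h2
    rw [hg, norm_mul, Complex.norm_exp]
    have : (-(ε * z) : ℂ).re = -(ε * z.re) := by simp
    rw [this]
    gcongr
    exact hb z h1 h2
  have hgc : ContinuousOn g {z | 0 ≤ z.re ∧ 0 ≤ z.im} :=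
    hcont.mul (Continuous.continuousOn (by fun_prop))
  have hgd : DifferentiableOn ℂ g {z | 0 < z.re ∧ 0 < z.im} :=
    hd.mul (Differentiable.differentiableOn (by fun_prop))
  have hrect : ∀ R : ℝ, 0 ≤ R → (∫ t in (0 : ℝ)..R, g t) -
      Complex.I * (∫ s in (0 : ℝ)..R, g (s * Complex.I)) =
      (∫ t in (0 : ℝ)..R, g (t + R * Complex.I)) -
        Complex.I * ∫ s in (0 : ℝ)..R, g (R + s * Complex.I) := by
    intro R hR
    have h := Complex.integral_boundary_rect_eq_zero_of_continuousOn_of_differentiableOn g 0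
      (R + R * Complex.I) (hgc.mono ?_) (hgd.mono ?_)
    · simp only [Complex.zero_re, Complex.zero_im, Complex.ofReal_re, Complex.ofReal_im,
        Complex.add_re, Complex.add_im, Complex.mul_re, Complex.mul_im, Complex.I_re, Complex.I_im,
        mul_zero, mul_one, zero_mul, sub_zero, add_zero, zero_add, smul_eq_mul,
        Complex.ofReal_zero] at h
      linear_combination h
    · rintro z ⟨h1, h2⟩
      simp only [Complex.zero_re, Complex.zero_im, Complex.ofReal_re, Complex.ofReal_im,
        Complex.add_re, Complex.add_im, Complex.mul_re, Complex.mul_im, Complex.I_re, Complex.I_im,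
        mul_zero, mul_one, sub_zero, add_zero, zero_add, mem_preimage, uIcc_of_le hR] at h1 h2
      exact ⟨h1.1, h2.1⟩
    · rintro z ⟨h1, h2⟩
      simp only [Complex.zero_re, Complex.zero_im, Complex.ofReal_re, Complex.ofReal_im,
        Complex.add_re, Complex.add_im, Complex.mul_re, Complex.mul_im, Complex.I_re, Complex.I_im,
        mul_zero, mul_one, sub_zero, add_zero, zero_add, mem_preimage, min_eq_left hR,
        max_eq_right hR] at h1 h2
      exact ⟨h1.1, h2.1⟩
  have hi1 : IntegrableOn (fun t : ℝ => g t) (Ioi 0) := by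
    refine Integrable.mono' ((integrableOn_one_add_mul_exp_neg hε).const_mul C)
      (ContinuousOn.aestronglyMeasurable ?_ measurableSet_Ioi) ?_
    · refine hgc.comp Complex.continuous_ofReal.continuousOn fun t ht => ?_
      simpa using le_of_lt ht
    · refine (ae_restrict_iff' measurableSet_Ioi).2 (Eventually.of_forall fun t ht => ?_)
      have ht0 : (0 : ℝ) ≤ t := le_of_lt ht
      have := hgb t (by simpa using ht0) (by simp)
      simp only [Complex.norm_real, Real.norm_of_nonneg ht0, Complex.ofReal_im, mul_zero, neg_zero,
        Real.exp_zero, mul_one, Complex.ofReal_re] at this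
      linarith
  have hi2 : IntegrableOn (fun s : ℝ => g (s * Complex.I)) (Ioi 0) := by
    refine Integrable.mono' ((integrableOn_one_add_mul_exp_neg hc).const_mul C)
      (ContinuousOn.aestronglyMeasurable ?_ measurableSet_Ioi) ?_
    · refine hgc.comp (Continuous.continuousOn (by fun_prop)) fun t ht => ?_
      simpa using le_of_lt ht
    · refine (ae_restrict_iff' measurableSet_Ioi).2 (Eventually.of_forall fun t ht => ?_)
      have ht0 : (0 : ℝ) ≤ t := le_of_lt ht
      have := hgb (t * Complex.I) (by simp) (by simpa using ht0)
      simp only [norm_mul, Complex.norm_I, mul_one, Complex.norm_real, Real.norm_of_nonneg ht0,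
        Complex.mul_im, Complex.mul_re, Complex.ofReal_re, Complex.ofReal_im, Complex.I_re,
        Complex.I_im, mul_zero, add_zero, sub_zero, neg_zero, Real.exp_zero] at this
      linarith
  have hnorm : ∀ R t : ℝ, 0 ≤ t → t ≤ R → ∀ z : ℂ, ‖z‖ ≤ t + R → 1 + ‖z‖ ≤ 1 + 2 * R := by
    intro R t h1 h2 z h3
    linarith
  have ht : Tendsto (fun R : ℝ => ∫ t in (0 : ℝ)..R, g (t + R * Complex.I)) atTop (𝓝 0) := by
    have := (tendsto_one_add_mul_mul_exp_neg hc).const_mul C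
    rw [mul_zero] at this
    refine squeeze_zero_norm' ?_ this
    filter_upwards [eventually_ge_atTop 0] with R hR
    have h := intervalIntegral.norm_integral_le_of_norm_le_const (a := 0) (b := R)
      (C := C * (1 + 2 * R) * Real.exp (-(c * R))) (f := fun t : ℝ => g (t + R * Complex.I)) ?_
    · rw [sub_zero, abs_of_nonneg hR] at h
      linarith
    · intro t ht
      rw [uIoc_of_le hR] at ht
      have hre : (t + R * Complex.I : ℂ).re = t := by simp
      have him : (t + R * Complex.I : ℂ).im = R := by simp
      have hn : ‖(t + R * Complex.I : ℂ)‖ ≤ t + R := by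
        have := Complex.norm_le_abs_re_add_abs_im (t + R * Complex.I : ℂ)
        rwa [hre, him, abs_of_nonneg ht.1.le, abs_of_nonneg hR] at this
      have := hgb (t + R * Complex.I) (by rw [hre]; exact ht.1.le) (by rw [him]; exact hR)
      rw [hre, him] at this
      refine this.trans ?_
      calc _ ≤ C * (1 + 2 * R) * Real.exp (-(c * R)) * 1 := by
            gcongr
            · linarith [ht.2]
            · exact Real.exp_le_one_iff.2 (by have := mul_pos hε ht.1; linarith)
        _ = _ := mul_one _
  have hr : Tendsto (fun R : ℝ => ∫ s in (0 : ℝ)..R, g (R + s * Complex.I)) atTop (𝓝 0) := by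
    have := (tendsto_one_add_mul_mul_exp_neg hε).const_mul C
    rw [mul_zero] at this
    refine squeeze_zero_norm' ?_ this
    filter_upwards [eventually_ge_atTop 0] with R hR
    have h := intervalIntegral.norm_integral_le_of_norm_le_const (a := 0) (b := R)
      (C := C * (1 + 2 * R) * Real.exp (-(ε * R))) (f := fun s : ℝ => g (R + s * Complex.I)) ?_
    · rw [sub_zero, abs_of_nonneg hR] at h
      linarith
    · intro s hs
      rw [uIoc_of_le hR] at hs
      have hre : (R + s * Complex.I : ℂ).re = R := by simp
      have him : (R + s * Complex.I : ℂ).im = s := by simp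
      have hn : ‖(R + s * Complex.I : ℂ)‖ ≤ R + s := by
        have := Complex.norm_le_abs_re_add_abs_im (R + s * Complex.I : ℂ)
        rwa [hre, him, abs_of_nonneg hs.1.le, abs_of_nonneg hR] at this
      have := hgb (R + s * Complex.I) (by rw [hre]; exact hR) (by rw [him]; exact hs.1.le)
      rw [hre, him] at this
      refine this.trans ?_
      calc _ ≤ C * (1 + 2 * R) * 1 * Real.exp (-(ε * R)) := by
            gcongr
            · linarith [hs.2]
            · exact Real.exp_le_one_iff.2 (by have := mul_pos hc hs.1; linarith)
        _ = _ := by ring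
  have l1 := (intervalIntegral_tendsto_integral_Ioi 0 hi1 tendsto_id).sub
    ((intervalIntegral_tendsto_integral_Ioi 0 hi2 tendsto_id).const_mul Complex.I)
  have l2 := ht.sub (hr.const_mul Complex.I)
  rw [mul_zero, sub_zero] at l2
  have l3 := l1.congr' (f₂ := fun R : ℝ => (∫ t in (0 : ℝ)..R, g (t + R * Complex.I)) -
        Complex.I * ∫ s in (0 : ℝ)..R, g (R + s * Complex.I)) (by
    filter_upwards [eventually_ge_atTop 0] with R hR
    exact hrect R hR)
  exact sub_eq_zero.1 (tendsto_nhds_unique l3 l2)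

/-- Rotation of the ray of integration by a right angle, for functions on the first quadrant that
decay exponentially upwards and whose real part is integrable on the positive real axis. -/
theorem integral_re_rotate_quadrant {f : ℂ → ℂ} {C c : ℝ} (hC : 0 < C) (hc : 0 < c)
    (hcont : ContinuousOn f {z | 0 ≤ z.re ∧ 0 ≤ z.im})
    (hd : DifferentiableOn ℂ f {z | 0 < z.re ∧ 0 < z.im})
    (hb : ∀ z : ℂ, 0 ≤ z.re → 0 ≤ z.im → ‖f z‖ ≤ C * (1 + ‖z‖) * Real.exp (-(c * z.im)))
    (hi : IntegrableOn (fun t : ℝ => (f t).re) (Ioi 0)) :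
    IntegrableOn (fun s : ℝ => f (s * Complex.I)) (Ioi 0) ∧
    ∫ t in Ioi (0 : ℝ), (f t).re = ∫ s in Ioi (0 : ℝ), (Complex.I * f (s * Complex.I)).re := by
  have hcr : ContinuousOn (fun t : ℝ => f t) (Ioi 0) :=
    hcont.comp Complex.continuous_ofReal.continuousOn fun t ht => by simpa using le_of_lt ht
  have hci : ContinuousOn (fun t : ℝ => f (t * Complex.I)) (Ioi 0) :=
    hcont.comp (Continuous.continuousOn (by fun_prop)) fun t ht => by simpa using le_of_lt ht
  have hib : ∀ s ∈ Ioi (0 : ℝ), ‖f (s * Complex.I)‖ ≤ C * ((1 + s) * Real.exp (-(c * s))) := by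
    intro s hs
    have hs0 : (0 : ℝ) ≤ s := le_of_lt hs
    have := hb (s * Complex.I) (by simp) (by simpa using hs0)
    simp only [norm_mul, Complex.norm_I, mul_one, Complex.norm_real, Real.norm_of_nonneg hs0,
      Complex.mul_im, Complex.ofReal_re, Complex.ofReal_im, Complex.I_re,
      Complex.I_im, mul_zero, add_zero] at this
    linarith
  have hii : IntegrableOn (fun s : ℝ => f (s * Complex.I)) (Ioi 0) :=
    Integrable.mono' ((integrableOn_one_add_mul_exp_neg hc).const_mul C)
      (hci.aestronglyMeasurable measurableSet_Ioi)
      ((ae_restrict_iff' measurableSet_Ioi).2 (Eventually.of_forall hib))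
  refine ⟨hii, ?_⟩
  -- On the real axis the damping factor is real and commutes with the real part. Hence the limit `ε
  -- → 0` needs only the integrability of `Re f` there.
  have hre : ∀ ε : ℝ, 0 < ε → ∫ t in Ioi (0 : ℝ), (f t).re * Real.exp (-(ε * t)) =
      (Complex.I * ∫ s in Ioi (0 : ℝ), f (s * Complex.I) *
        Complex.exp (-(ε * (s * Complex.I)))).re := by
    intro ε hε
    rw [← integral_rotate_quadrant_aux hC hc hε hcont hd hb]
    have hint : IntegrableOn (fun t : ℝ => f t * Complex.exp (-(ε * t))) (Ioi 0) := by
      refine Integrable.mono' ((integrableOn_one_add_mul_exp_neg hε).const_mul C)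
        ((hcr.mul (Continuous.continuousOn (by fun_prop))).aestronglyMeasurable measurableSet_Ioi) ?_
      refine (ae_restrict_iff' measurableSet_Ioi).2 (Eventually.of_forall fun t ht => ?_)
      have ht0 : (0 : ℝ) ≤ t := le_of_lt ht
      have := hb t (by simpa using ht0) (by simp)
      simp only [Complex.norm_real, Real.norm_of_nonneg ht0, Complex.ofReal_im, mul_zero, neg_zero,
        Real.exp_zero, mul_one] at this
      rw [norm_mul, Complex.norm_exp, show (-(ε * t) : ℂ).re = -(ε * t) by simp, ← mul_assoc]
      gcongr
    have h := integral_re hint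
    refine Eq.trans (integral_congr_ae (Eventually.of_forall fun t => ?_)) h
    change (f t).re * Real.exp (-(ε * t)) = (f t * Complex.exp (-(ε * t))).re
    rw [show (-(ε * t) : ℂ) = ((-(ε * t) : ℝ) : ℂ) by push_cast; rfl, ← Complex.ofReal_exp,
      Complex.re_mul_ofReal]
  have hmem : ∀ᶠ ε : ℝ in 𝓝[>] 0, 0 < ε := eventually_mem_nhdsWithin
  have l1 : Tendsto (fun ε : ℝ => ∫ t in Ioi (0 : ℝ), (f t).re * Real.exp (-(ε * t))) (𝓝[>] 0)
      (𝓝 (∫ t in Ioi (0 : ℝ), (f t).re)) := by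
    refine tendsto_integral_filter_of_dominated_convergence (fun t => |(f t).re|) ?_ ?_ hi.abs ?_
    · exact Eventually.of_forall fun ε =>
        ((Complex.continuous_re.comp_continuousOn hcr).mul
          (Continuous.continuousOn (by fun_prop))).aestronglyMeasurable measurableSet_Ioi
    · filter_upwards [hmem] with ε hε
      refine (ae_restrict_iff' measurableSet_Ioi).2 (Eventually.of_forall fun t ht => ?_)
      rw [norm_mul, Real.norm_of_nonneg (Real.exp_nonneg _)]
      refine mul_le_of_le_one_right (abs_nonneg _) (Real.exp_le_one_iff.2 ?_)
      have := mul_pos hε ht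
      linarith
    · refine Eventually.of_forall fun t => Tendsto.mono_left ?_ nhdsWithin_le_nhds
      have : Continuous fun ε : ℝ => (f t).re * Real.exp (-(ε * t)) := by fun_prop
      simpa using this.tendsto 0
  have l2 : Tendsto (fun ε : ℝ => ∫ s in Ioi (0 : ℝ), f (s * Complex.I) *
      Complex.exp (-(ε * (s * Complex.I)))) (𝓝[>] 0)
      (𝓝 (∫ s in Ioi (0 : ℝ), f (s * Complex.I))) := by
    refine tendsto_integral_filter_of_dominated_convergence (fun s => ‖f (s * Complex.I)‖) ?_ ?_
      hii.norm ?_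
    · exact Eventually.of_forall fun ε =>
        (hci.mul (Continuous.continuousOn (by fun_prop))).aestronglyMeasurable measurableSet_Ioi
    · refine Eventually.of_forall fun ε => Eventually.of_forall fun s => ?_
      rw [norm_mul, Complex.norm_exp]
      simp
    · refine Eventually.of_forall fun t => Tendsto.mono_left ?_ nhdsWithin_le_nhds
      have : Continuous fun ε : ℝ => f (t * Complex.I) *
        Complex.exp (-(ε * (t * Complex.I))) := by fun_prop
      simpa using this.tendsto 0
  have l3 := (Complex.continuous_re.tendsto _).comp (l2.const_mul Complex.I)
  have l4 := l1.congr' (by filter_upwards [hmem] with ε hε using hre ε hε)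
  rw [tendsto_nhds_unique l4 l3, ← integral_const_mul]
  exact (integral_re (hii.const_mul Complex.I)).symm

/-! ### The integral of `I₀(xs) I₀(s) K₀(s)⁴` for `p₅`. -/

/-- With `H = H₀⁽¹⁾` and `H' = H₀⁽²⁾ = 2J₀ - H`, the half `z J₀(xz) (H⁵ + 5H⁴H' + 10H³H'²)` of the
binomial expansion of `z J₀(xz) (H + H')⁵` that decays in the upper half plane. -/
noncomputable def walkKernel (η x : ℝ) (z : ℂ) : ℂ :=
  z * besselJC (x * z) * (hankel η z ^ 5 + 5 * hankel η z ^ 4 * (2 * besselJC z - hankel η z) +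
    10 * hankel η z ^ 3 * (2 * besselJC z - hankel η z) ^ 2)

/-- On the positive axis `H'` is the conjugate of `H`, so the two halves of `(H + H')⁵ = 32 J₀⁵` are
conjugate and each has real part `16 J₀⁵`. -/
theorem re_walkKernel_ofReal {η x t : ℝ} (h0 : 0 < η) (h1 : η ≤ π / 2) (ht : 0 < t) :
    (walkKernel η x t).re = 16 * (t * besselJ0 (x * t) * besselJ0 t ^ 5) := by
  have hr := re_hankel_ofReal h0 h1 ht
  set H := hankel η t with hH
  have hH1 : H = besselJ0 t + H.im * Complex.I := by
    rw [← hr]; exact (Complex.re_add_im H).symm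
  have e : walkKernel η x t = ((t * besselJ0 (x * t) : ℝ) : ℂ) *
      (H ^ 5 + 5 * H ^ 4 * (2 * besselJ0 t - H) + 10 * H ^ 3 * (2 * besselJ0 t - H) ^ 2) := by
    unfold walkKernel
    rw [← Complex.ofReal_mul, besselJC_ofReal, besselJC_ofReal]
    push_cast
    rfl
  rw [e, Complex.re_ofReal_mul]
  generalize H.im = y at hH1
  generalize besselJ0 t = J at hH1
  have h3 : (y * Complex.I) ^ 3 = -(y : ℂ) ^ 3 * Complex.I := by
    rw [mul_pow, Complex.I_pow_three]; ring
  have h5 : (y * Complex.I) ^ 5 = (y : ℂ) ^ 5 * Complex.I := by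
    rw [mul_pow, pow_succ Complex.I 4, Complex.I_pow_four, one_mul]
  have e2 : H ^ 5 + 5 * H ^ 4 * (2 * J - H) + 10 * H ^ 3 * (2 * J - H) ^ 2 =
      ((16 * J ^ 5 : ℝ) : ℂ) +
        ((30 * J ^ 4 * y + 20 * J ^ 2 * y ^ 3 + 6 * y ^ 5 : ℝ) : ℂ) * Complex.I := by
    rw [hH1]
    push_cast
    linear_combination (-20 * (J : ℂ) ^ 2) * h3 + 6 * h5
  rw [e2, Complex.add_re, Complex.ofReal_re, Complex.re_ofReal_mul, Complex.I_re]
  ring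

/-- With `k = 2K₀/π` one has `H = -ik` and `H' = 2I₀ + ik`. The terms in `k⁵` and `I₀² k³` become
purely imaginary, leaving `30 I₀ k⁴`. -/
theorem re_I_mul_walkKernel_ofReal_mul_I {η x s : ℝ} (h0 : 0 ≤ η) (h1 : η < π / 2) (hs : 0 < s) :
    (Complex.I * walkKernel η x (s * Complex.I)).re =
      480 / π ^ 4 * (s * besselI0 (x * s) * besselI0 s * besselK0 s ^ 4) := by
  unfold walkKernel
  rw [← mul_assoc (x : ℂ), ← Complex.ofReal_mul, besselJC_ofReal_mul_I, besselJC_ofReal_mul_I,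
    hankel_ofReal_mul_I h0 h1 hs]
  have hk : 480 / π ^ 4 * (s * besselI0 (x * s) * besselI0 s * besselK0 s ^ 4) =
      30 * (s * besselI0 (x * s)) * besselI0 s * (2 / π * besselK0 s) ^ 4 := by
    field_simp; ring
  rw [hk]
  generalize 2 / π * besselK0 s = k
  generalize besselI0 s = i
  generalize besselI0 (x * s) = j
  have h3 : (-(k : ℂ) * Complex.I) ^ 3 = k ^ 3 * Complex.I := by
    rw [mul_pow, Complex.I_pow_three]; ring
  have h4 : (-(k : ℂ) * Complex.I) ^ 4 = k ^ 4 := by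
    rw [mul_pow, Complex.I_pow_four]; ring
  have h5 : (-(k : ℂ) * Complex.I) ^ 5 = -k ^ 5 * Complex.I := by
    rw [pow_succ, h4]; ring
  have e : Complex.I * (s * Complex.I * j * ((-(k : ℂ) * Complex.I) ^ 5 +
      5 * (-(k : ℂ) * Complex.I) ^ 4 * (2 * i - -(k : ℂ) * Complex.I) +
      10 * (-(k : ℂ) * Complex.I) ^ 3 * (2 * i - -(k : ℂ) * Complex.I) ^ 2)) =
      ((30 * (s * j) * i * k ^ 4 : ℝ) : ℂ) +
        ((s * j * (6 * k ^ 5 - 40 * i ^ 2 * k ^ 3) : ℝ) : ℂ) * Complex.I := by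
    push_cast
    have hI := Complex.I_sq
    generalize -(k : ℂ) * Complex.I = w at h3 h4 h5
    linear_combination (s * j * (6 * w ^ 5 - 30 * i * w ^ 4 + 40 * i ^ 2 * w ^ 3)) * hI
      - s * j * (6 * h5 - 30 * i * h4 + 40 * i ^ 2 * h3)
  rw [e, Complex.add_re, Complex.ofReal_re, Complex.re_ofReal_mul, Complex.I_re]
  ring

theorem differentiableAt_walkKernel {η : ℝ} (x : ℝ) {z : ℂ}
    (hz : 0 < z.re * Real.sin η + z.im * Real.cos η) :
    DifferentiableAt ℂ (walkKernel η x) z := by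
  have h1 := differentiableAt_hankel hz
  have h2 := differentiable_besselJC z
  have h3 : DifferentiableAt ℂ (fun z : ℂ => besselJC (x * z)) z :=
    (differentiable_besselJC _).comp z (by fun_prop)
  unfold walkKernel
  fun_prop

theorem exists_norm_walkKernel_le {x : ℝ} (hx0 : 0 ≤ x) (hx1 : x < 1) :
    ∃ η, 0 < η ∧ η < π / 2 ∧ ∃ C c : ℝ, 0 < C ∧ 0 < c ∧ ∀ z : ℂ, 0 ≤ z.re → 0 ≤ z.im →
      ‖walkKernel η x z‖ ≤ C * (‖z‖ + ‖z‖ ^ (3 / 8 : ℝ)) * Real.exp (-(c * z.im)) := by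
  -- The worst term decays at rate `3κ - 2 - x`; this `κ < 1` makes that equal to `(1 - x)/2`.
  set κ := (x + 5) / 6 with hκ
  have hκ1 : κ < 1 := by rw [hκ]; linarith
  have hκ0 : 0 ≤ κ := by rw [hκ]; linarith
  obtain ⟨η, ⟨hη0, hη1⟩, hη⟩ : ∃ η ∈ Ioo 0 (π / 2), κ < Real.cos η := by
    have h1 : ∀ᶠ η in 𝓝[>] (0 : ℝ), κ < Real.cos η :=
      (Real.continuous_cos.continuousAt.eventually_const_lt (by simpa using hκ1)).filter_mono
        nhdsWithin_le_nhds
    have h2 : ∀ᶠ η in 𝓝[>] (0 : ℝ), η ∈ Ioo 0 (π / 2) := Ioo_mem_nhdsGT (by positivity)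
    obtain ⟨η, h⟩ := (h2.and h1).exists
    exact ⟨η, h.1, h.2⟩
  obtain ⟨C, hC, hb⟩ := exists_norm_hankel_le hη0 hη1 hκ0 hη
  refine ⟨η, hη0, hη1, 16 * (C ^ 5 + 5 * C ^ 4 * (2 + C) + 10 * C ^ 3 * (2 + C) ^ 2),
    (1 - x) / 2, by positivity, by linarith, fun z hre him => ?_⟩
  rcases eq_or_ne z 0 with rfl | hz
  · simp [walkKernel]
  have hr : 0 < ‖z‖ := norm_pos_iff.2 hz
  have hH := hb z hz hre him
  set H := hankel η z
  set r := ‖z‖ ^ (-(1 / 8) : ℝ) with hrdef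
  have hr0 : 0 ≤ r := by positivity
  set A := Real.exp (-(κ * z.im)) with hA
  set B := Real.exp z.im with hB
  have hA0 : 0 < A := Real.exp_pos _
  have hA1 : A ≤ 1 := Real.exp_le_one_iff.2 (by have := mul_nonneg hκ0 him; linarith)
  have hB1 : 1 ≤ B := Real.one_le_exp him
  have hJ : ‖besselJC z‖ ≤ B := by
    have := norm_besselJC_le z
    rwa [abs_of_nonneg him] at this
  have hJx : ‖besselJC (x * z)‖ ≤ Real.exp (x * z.im) := by
    have := norm_besselJC_le (x * z)
    rwa [Complex.im_ofReal_mul, abs_of_nonneg (mul_nonneg hx0 him)] at this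
  have hu1 : 1 ≤ 1 + r := by linarith
  have hu0 : 0 < 1 + r := by linarith
  have hH2 : ‖2 * besselJC z - H‖ ≤ (2 + C) * (1 + r) * B := by
    calc _ ≤ 2 * ‖besselJC z‖ + ‖H‖ := by
          refine (norm_sub_le _ _).trans ?_
          rw [norm_mul, Complex.norm_ofNat]
      _ ≤ 2 * B * (1 + r) + C * (1 + r) * B := by
          have h1 : 2 * ‖besselJC z‖ ≤ 2 * B * (1 + r) := by
            calc _ ≤ 2 * B := by gcongr
              _ ≤ _ := le_mul_of_one_le_right (by positivity) hu1
          have h2 : ‖H‖ ≤ C * (1 + r) * B := hH.trans (by gcongr; linarith)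
          linarith
      _ = _ := by ring
  set D := ‖2 * besselJC z - H‖
  have hu5 : ‖z‖ * (1 + r) ^ 5 ≤ 16 * (‖z‖ + ‖z‖ ^ (3 / 8 : ℝ)) := by
    have h1 : (1 + r) ^ 5 ≤ 16 * (1 + r ^ 5) := by
      have := add_pow_le zero_le_one hr0 5
      norm_num at this
      linarith
    have h2 : ‖z‖ * r ^ 5 = ‖z‖ ^ (3 / 8 : ℝ) := by
      rw [hrdef, ← Real.rpow_natCast, ← Real.rpow_mul hr.le]
      nth_rewrite 1 [← Real.rpow_one ‖z‖]
      rw [← Real.rpow_add hr]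
      norm_num
    calc _ ≤ ‖z‖ * (16 * (1 + r ^ 5)) := by gcongr
      _ = _ := by rw [← h2]; ring
  have hAB : A ≤ B := hA1.trans hB1
  have hS : ‖H ^ 5 + 5 * H ^ 4 * (2 * besselJC z - H) + 10 * H ^ 3 * (2 * besselJC z - H) ^ 2‖ ≤
      (C ^ 5 + 5 * C ^ 4 * (2 + C) + 10 * C ^ 3 * (2 + C) ^ 2) * (1 + r) ^ 5 * (A ^ 3 * B ^ 2) := by
    calc _ ≤ ‖H‖ ^ 5 + 5 * ‖H‖ ^ 4 * D + 10 * ‖H‖ ^ 3 * D ^ 2 := by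
          refine norm_add₃_le.trans (le_of_eq ?_)
          simp only [norm_mul, norm_pow, Complex.norm_ofNat]
          rfl
      _ ≤ (C * (1 + r) * A) ^ 5 + 5 * (C * (1 + r) * A) ^ 4 * ((2 + C) * (1 + r) * B) +
          10 * (C * (1 + r) * A) ^ 3 * ((2 + C) * (1 + r) * B) ^ 2 := by gcongr
      _ = (C ^ 5 * (1 + r) ^ 5) * (A ^ 3 * A ^ 2) +
          (5 * C ^ 4 * (2 + C) * (1 + r) ^ 5) * (A ^ 3 * (A * B)) +
          (10 * C ^ 3 * (2 + C) ^ 2 * (1 + r) ^ 5) * (A ^ 3 * B ^ 2) := by ring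
      _ ≤ (C ^ 5 * (1 + r) ^ 5) * (A ^ 3 * B ^ 2) +
          (5 * C ^ 4 * (2 + C) * (1 + r) ^ 5) * (A ^ 3 * (B * B)) +
          (10 * C ^ 3 * (2 + C) ^ 2 * (1 + r) ^ 5) * (A ^ 3 * B ^ 2) := by gcongr
      _ = _ := by ring
  have hexp : Real.exp (x * z.im) * (A ^ 3 * B ^ 2) = Real.exp (-((1 - x) / 2 * z.im)) := by
    rw [hA, hB, ← Real.exp_nat_mul, ← Real.exp_nat_mul, ← Real.exp_add, ← Real.exp_add, hκ]
    congr 1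
    push_cast
    ring
  unfold walkKernel
  rw [norm_mul, norm_mul]
  set K := C ^ 5 + 5 * C ^ 4 * (2 + C) + 10 * C ^ 3 * (2 + C) ^ 2 with hK
  have hK0 : 0 < K := by positivity
  calc _ ≤ ‖z‖ * Real.exp (x * z.im) * (K * (1 + r) ^ 5 * (A ^ 3 * B ^ 2)) := by gcongr
    _ = K * (‖z‖ * (1 + r) ^ 5) * (Real.exp (x * z.im) * (A ^ 3 * B ^ 2)) := by ring
    _ ≤ K * (16 * (‖z‖ + ‖z‖ ^ (3 / 8 : ℝ))) * (Real.exp (x * z.im) * (A ^ 3 * B ^ 2)) := by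
        gcongr
    _ = _ := by rw [hexp]; ring

/-- For `0 ≤ x < 1`, the density is `p₅(x) = (30/π⁴) ∫₀^∞ x s I₀(xs) I₀(s) K₀(s)⁴ ds`. -/
theorem kluyverP5_eq_integral {x : ℝ} (hx0 : 0 ≤ x) (hx1 : x < 1) :
    kluyverP5 x = 30 / π ^ 4 * x *
      ∫ s in Ioi (0 : ℝ), s * besselI0 (x * s) * besselI0 s * besselK0 s ^ 4 := by
  rcases hx0.eq_or_lt with rfl | hxpos
  · simp [kluyverP5, kluyverIntegrand5]
  obtain ⟨η, hη0, hη1, C, c, hC, hc, hb⟩ := exists_norm_walkKernel_le hx0 hx1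
  have hs : 0 < Real.sin η := Real.sin_pos_of_pos_of_lt_pi hη0 (by linarith [Real.pi_pos])
  have hcos : 0 < Real.cos η := Real.cos_pos_of_mem_Ioo ⟨by linarith, hη1⟩
  have hcont : ContinuousOn (walkKernel η x) {z | 0 ≤ z.re ∧ 0 ≤ z.im} := by
    rintro z ⟨hre, him⟩
    rcases eq_or_ne z 0 with rfl | hz
    -- The Sommerfeld integral diverges at `0`, where `hankel` has a default value; the factor `z`
    -- makes it irrelevant, and the bound `‖z‖ + ‖z‖^(3/8)` gives continuity.
    · have h0 : walkKernel η x 0 = 0 := by simp [walkKernel]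
      rw [ContinuousWithinAt, h0]
      refine squeeze_zero_norm' (a := fun z : ℂ => C * (‖z‖ + ‖z‖ ^ (3 / 8 : ℝ))) ?_ ?_
      · filter_upwards [self_mem_nhdsWithin] with z hz
        refine (hb z hz.1 hz.2).trans (mul_le_of_le_one_right (by positivity) ?_)
        exact Real.exp_le_one_iff.2 (by have := mul_nonneg hc.le hz.2; linarith)
      · have h1 : Continuous fun z : ℂ => C * (‖z‖ + ‖z‖ ^ (3 / 8 : ℝ)) := by
          refine continuous_const.mul (continuous_norm.add ?_)
          exact continuous_norm.rpow_const fun _ => Or.inr (by norm_num)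
        have := h1.tendsto 0
        rw [norm_zero, Real.zero_rpow (by norm_num), add_zero, mul_zero] at this
        exact this.mono_left nhdsWithin_le_nhds
    · refine (differentiableAt_walkKernel x ?_).continuousAt.continuousWithinAt
      have h1 := mul_nonneg hre hs.le
      have h2 := mul_nonneg him hcos.le
      rcases hre.eq_or_lt with h | h
      · have : 0 < z.im := him.lt_of_ne fun h' => hz (Complex.ext h.symm h'.symm)
        have := mul_pos this hcos
        linarith
      · have := mul_pos h hs
        linarith
  have hd : DifferentiableOn ℂ (walkKernel η x) {z | 0 < z.re ∧ 0 < z.im} := by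
    rintro z ⟨hre, him⟩
    refine (differentiableAt_walkKernel x ?_).differentiableWithinAt
    have h1 := mul_pos hre hs
    have h2 := mul_pos him hcos
    linarith
  have hb' : ∀ z : ℂ, 0 ≤ z.re → 0 ≤ z.im →
      ‖walkKernel η x z‖ ≤ (2 * C) * (1 + ‖z‖) * Real.exp (-(c * z.im)) := by
    intro z hre him
    refine (hb z hre him).trans ?_
    have h1 : ‖z‖ ^ (3 / 8 : ℝ) ≤ 1 + ‖z‖ := by
      calc _ ≤ (1 + ‖z‖) ^ (3 / 8 : ℝ) := by gcongr; linarith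
        _ ≤ (1 + ‖z‖) ^ (1 : ℝ) := by
            refine Real.rpow_le_rpow_of_exponent_le ?_ (by norm_num)
            linarith [norm_nonneg z]
        _ = _ := Real.rpow_one _
    have h2 : C * (‖z‖ + ‖z‖ ^ (3 / 8 : ℝ)) ≤ C * (‖z‖ + (1 + ‖z‖)) := by gcongr
    refine mul_le_mul_of_nonneg_right ?_ (Real.exp_nonneg _)
    linarith
  have hre : ∀ t ∈ Ioi (0 : ℝ), (walkKernel η x t).re = 16 / x * kluyverIntegrand5 x t := by
    intro t ht
    rw [re_walkKernel_ofReal hη0 hη1.le ht]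
    unfold kluyverIntegrand5
    field_simp
  have hi : IntegrableOn (fun t : ℝ => (walkKernel η x t).re) (Ioi 0) :=
    IntegrableOn.congr_fun ((integrableOn_kluyverIntegrand5 x).const_mul (16 / x))
      (fun t ht => (hre t ht).symm) measurableSet_Ioi
  have h := (integral_re_rotate_quadrant (by positivity) hc hcont hd hb' hi).2
  rw [setIntegral_congr_fun measurableSet_Ioi hre,
    setIntegral_congr_fun measurableSet_Ioi
      (fun s hs => re_I_mul_walkKernel_ofReal_mul_I hη0.le hη1 hs),
    integral_const_mul, integral_const_mul] at h
  unfold kluyverP5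
  field_simp at h ⊢
  linarith

/-! ### Derivatives and bounds of `K₀` and `s K₁`. -/

/-- `s K₁(s) = -s K₀'(s)`. -/
noncomputable def besselD (s : ℝ) : ℝ :=
  s * ∫ b in Ioi (0 : ℝ), Real.cosh b * Real.exp (-(s * Real.cosh b))

theorem half_exp_le_cosh (b : ℝ) : Real.exp b / 2 ≤ Real.cosh b := by
  rw [Real.cosh_eq]
  linarith [Real.exp_pos (-b)]

theorem cosh_le_exp {b : ℝ} (hb : 0 ≤ b) : Real.cosh b ≤ Real.exp b := by
  rw [Real.cosh_eq]
  have : Real.exp (-b) ≤ Real.exp b := Real.exp_le_exp.2 (by linarith)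
  linarith

/-- Half of the exponential decay is spent on one factor `exp b`. The bound is uniform in `s ≥ m`,
as differentiation under the integral requires. -/
theorem sq_cosh_mul_exp_le {m s b : ℝ} (hm : 0 < m) (hs : m ≤ s) (hb : 0 ≤ b) :
    Real.cosh b ^ 2 * Real.exp (-(s * Real.cosh b)) ≤
      4 / m * (Real.exp b * Real.exp (-(m / 4 * Real.exp b))) := by
  have h1 : m / 4 * Real.exp b ≤ Real.exp (m / 4 * Real.exp b) := by
    linarith [Real.add_one_le_exp (m / 4 * Real.exp b)]
  have h2 : Real.exp b ≤ 4 / m * Real.exp (m / 4 * Real.exp b) := by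
    rw [div_mul_eq_mul_div, le_div_iff₀ hm]
    linarith
  have h3 : m * (Real.exp b / 2) ≤ s * Real.cosh b :=
    mul_le_mul hs (half_exp_le_cosh b) (by positivity) (by linarith)
  calc _ ≤ Real.exp b ^ 2 * Real.exp (-(m * (Real.exp b / 2))) := by
        gcongr; exact cosh_le_exp hb
    _ ≤ (Real.exp b * (4 / m * Real.exp (m / 4 * Real.exp b))) *
        Real.exp (-(m * (Real.exp b / 2))) := by
        gcongr; rw [sq]; gcongr
    _ = 4 / m * (Real.exp b * (Real.exp (m / 4 * Real.exp b) *
        Real.exp (-(m * (Real.exp b / 2))))) := by ring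
    _ = _ := by rw [← Real.exp_add]; congr 3; ring

theorem integrableOn_sq_cosh_mul_exp {s : ℝ} (hs : 0 < s) :
    IntegrableOn (fun b => Real.cosh b ^ 2 * Real.exp (-(s * Real.cosh b))) (Ioi 0) := by
  refine Integrable.mono' ((integrableOn_exp_mul_exp_neg_mul_exp (m := s / 4)
    (by positivity)).const_mul (4 / s)) (Continuous.aestronglyMeasurable (by fun_prop)) ?_
  refine (ae_restrict_iff' measurableSet_Ioi).2 (Eventually.of_forall fun b hb => ?_)
  rw [Real.norm_of_nonneg (by positivity)]
  exact sq_cosh_mul_exp_le hs le_rfl (le_of_lt hb)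

theorem integrableOn_cosh_mul_exp {s : ℝ} (hs : 0 < s) :
    IntegrableOn (fun b => Real.cosh b * Real.exp (-(s * Real.cosh b))) (Ioi 0) := by
  refine Integrable.mono' (integrableOn_sq_cosh_mul_exp hs)
    (Continuous.aestronglyMeasurable (by fun_prop)) (Eventually.of_forall fun b => ?_)
  have := Real.one_le_cosh b
  rw [Real.norm_of_nonneg (by positivity)]
  gcongr
  nlinarith

theorem integrableOn_exp_neg_mul_cosh {s : ℝ} (hs : 0 < s) :
    IntegrableOn (fun b => Real.exp (-(s * Real.cosh b))) (Ioi 0) := by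
  refine Integrable.mono' (integrableOn_cosh_mul_exp hs)
    (Continuous.aestronglyMeasurable (by fun_prop)) (Eventually.of_forall fun b => ?_)
  rw [Real.norm_of_nonneg (by positivity)]
  exact le_mul_of_one_le_left (Real.exp_nonneg _) (Real.one_le_cosh b)

theorem hasDerivAt_integral_exp_neg_mul_cosh (n : ℕ) (hn : n ≤ 1) {s : ℝ} (hs : 0 < s) :
    HasDerivAt (fun s => ∫ b in Ioi (0 : ℝ), Real.cosh b ^ n * Real.exp (-(s * Real.cosh b)))
      (-∫ b in Ioi (0 : ℝ), Real.cosh b ^ (n + 1) * Real.exp (-(s * Real.cosh b))) s := by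
  have h := (hasDerivAt_integral_of_dominated_loc_of_deriv_le
    (μ := volume.restrict (Ioi 0)) (x₀ := s) (s := Ioi (s / 2))
    (F := fun (s b : ℝ) => Real.cosh b ^ n * Real.exp (-(s * Real.cosh b)))
    (F' := fun (s b : ℝ) => -(Real.cosh b ^ (n + 1) * Real.exp (-(s * Real.cosh b))))
    (bound := fun b => 4 / (s / 2) * (Real.exp b * Real.exp (-(s / 2 / 4 * Real.exp b))))
    (Ioi_mem_nhds (by linarith)) ?_ ?_ ?_ ?_ ?_ ?_).2
  · rwa [integral_neg] at h
  · exact Eventually.of_forall fun t => Continuous.aestronglyMeasurable (by fun_prop)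
  · interval_cases n
    · simpa using! integrableOn_exp_neg_mul_cosh hs
    · simpa using! integrableOn_cosh_mul_exp hs
  · exact Continuous.aestronglyMeasurable (by fun_prop)
  · refine (ae_restrict_iff' measurableSet_Ioi).2 (Eventually.of_forall fun b hb x hx => ?_)
    have hc := Real.one_le_cosh b
    rw [norm_neg, Real.norm_of_nonneg (by positivity)]
    refine le_trans ?_ (sq_cosh_mul_exp_le (half_pos hs) (le_of_lt hx) (le_of_lt hb))
    gcongr; omega
  · exact (integrableOn_exp_mul_exp_neg_mul_exp (by positivity)).const_mul _
  · refine Eventually.of_forall fun b x _ => ?_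
    refine (((hasDerivAt_mul_const (x := x) (Real.cosh b)).neg.exp).const_mul
      (Real.cosh b ^ n)).congr_deriv ?_
    simp only [Pi.neg_apply]
    ring

theorem hasDerivAt_besselK0 {s : ℝ} (hs : 0 < s) :
    HasDerivAt besselK0 (-(besselD s / s)) s := by
  have h := hasDerivAt_integral_exp_neg_mul_cosh 0 (by norm_num) hs
  simp only [pow_zero, one_mul, zero_add, pow_one] at h
  refine h.congr_deriv ?_
  rw [besselD, mul_div_cancel_left₀ _ hs.ne']

theorem tendsto_exp_mul_exp_neg_mul_exp {m : ℝ} (hm : 0 < m) :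
    Tendsto (fun b => Real.exp b * Real.exp (-(m * Real.exp b))) atTop (𝓝 0) := by
  have h := (tendsto_rpow_mul_exp_neg_mul_atTop_nhds_zero 1 m hm).comp Real.tendsto_exp_atTop
  refine h.congr fun b => ?_
  simp

/-- The integrand is the derivative of `sinh b · exp (-s cosh b)`, which vanishes at `0` and at `∞`.
This is Bessel's equation for `K₀`, in the form that gives `(s K₁)' = -s K₀`. -/
theorem integral_sinh_sq {s : ℝ} (hs : 0 < s) :
    ∫ b in Ioi (0 : ℝ), (Real.cosh b * Real.exp (-(s * Real.cosh b)) -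
      s * (Real.cosh b ^ 2 * Real.exp (-(s * Real.cosh b)) - Real.exp (-(s * Real.cosh b)))) = 0 := by
  have h := integral_Ioi_of_hasDerivAt_of_tendsto' (a := 0) (m := 0)
    (f := fun b => Real.sinh b * Real.exp (-(s * Real.cosh b)))
    (f' := fun b => Real.cosh b * Real.exp (-(s * Real.cosh b)) -
      s * (Real.cosh b ^ 2 * Real.exp (-(s * Real.cosh b)) - Real.exp (-(s * Real.cosh b))))
    ?_ ?_ ?_
  · simpa using h
  · intro b _
    refine ((Real.hasDerivAt_sinh b).mul
      (((Real.hasDerivAt_cosh b).const_mul s).neg.exp)).congr_deriv ?_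
    simp only [Pi.neg_apply]
    have := Real.cosh_sq b
    rw [this]
    ring
  · exact (integrableOn_cosh_mul_exp hs).sub (((integrableOn_sq_cosh_mul_exp hs).sub
      (integrableOn_exp_neg_mul_cosh hs)).const_mul s)
  · refine squeeze_zero' ?_ ?_ (tendsto_exp_mul_exp_neg_mul_exp (half_pos hs))
    · filter_upwards [eventually_ge_atTop 0] with b hb
      exact mul_nonneg (Real.sinh_nonneg_iff.2 hb) (Real.exp_nonneg _)
    · filter_upwards [eventually_ge_atTop 0] with b hb
      have h1 := (Real.sinh_lt_cosh b).le.trans (cosh_le_exp hb)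
      have h2 : s / 2 * Real.exp b ≤ s * Real.cosh b := by
        have := mul_le_mul_of_nonneg_left (half_exp_le_cosh b) hs.le
        linarith
      gcongr

theorem hasDerivAt_besselD {s : ℝ} (hs : 0 < s) :
    HasDerivAt besselD (-(s * besselK0 s)) s := by
  have h := (hasDerivAt_id s).mul (hasDerivAt_integral_exp_neg_mul_cosh 1 le_rfl hs)
  simp only [pow_one] at h
  refine h.congr_deriv ?_
  have h2 := integral_sinh_sq hs
  have hi : IntegrableOn (fun b => s * (Real.cosh b ^ 2 * Real.exp (-(s * Real.cosh b)) -
      Real.exp (-(s * Real.cosh b)))) (Ioi 0) :=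
    ((integrableOn_sq_cosh_mul_exp hs).sub (integrableOn_exp_neg_mul_cosh hs)).const_mul s
  rw [integral_sub (integrableOn_cosh_mul_exp hs) hi, integral_const_mul,
    integral_sub (integrableOn_sq_cosh_mul_exp hs) (integrableOn_exp_neg_mul_cosh hs)] at h2
  unfold besselK0
  simp only [id]
  linarith

theorem besselK0_nonneg (s : ℝ) : 0 ≤ besselK0 s :=
  integral_nonneg fun _ => Real.exp_nonneg _

theorem besselK0_pos {s : ℝ} (hs : 0 < s) : 0 < besselK0 s := by
  unfold besselK0
  rw [setIntegral_pos_iff_support_of_nonneg_ae (Eventually.of_forall fun _ => Real.exp_nonneg _)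
    (integrableOn_exp_neg_mul_cosh hs)]
  rw [Function.support_eq_univ fun _ => Real.exp_ne_zero _, univ_inter, Real.volume_Ioi]
  exact ENNReal.zero_lt_top

theorem besselD_nonneg {s : ℝ} (hs : 0 ≤ s) : 0 ≤ besselD s :=
  mul_nonneg hs (integral_nonneg fun b => by have := Real.one_le_cosh b; positivity)

theorem integral_mul_sinh_mul_exp {s : ℝ} (hs : 0 < s) :
    IntegrableOn (fun b => s * (Real.sinh b * Real.exp (-(s * Real.cosh b)))) (Ioi 0) ∧
    ∫ b in Ioi (0 : ℝ), s * (Real.sinh b * Real.exp (-(s * Real.cosh b))) = Real.exp (-s) := by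
  have hd : ∀ b ∈ Ici (0 : ℝ), HasDerivAt (fun b => -Real.exp (-(s * Real.cosh b)))
      (s * (Real.sinh b * Real.exp (-(s * Real.cosh b)))) b := by
    intro b _
    refine (((Real.hasDerivAt_cosh b).const_mul s).neg.exp).neg.congr_deriv ?_
    simp only [Pi.neg_apply]
    ring
  have hl : Tendsto (fun b => -Real.exp (-(s * Real.cosh b))) atTop (𝓝 (-0)) := by
    refine Tendsto.neg (Real.tendsto_exp_neg_atTop_nhds_zero.comp ?_)
    refine Tendsto.const_mul_atTop hs (tendsto_atTop_mono half_exp_le_cosh ?_)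
    exact Real.tendsto_exp_atTop.atTop_div_const two_pos
  have hp : ∀ b ∈ Ioi (0 : ℝ), 0 ≤ s * (Real.sinh b * Real.exp (-(s * Real.cosh b))) :=
    fun b hb => mul_nonneg hs.le (mul_nonneg (Real.sinh_nonneg_iff.2 (le_of_lt hb))
      (Real.exp_nonneg _))
  refine ⟨integrableOn_Ioi_deriv_of_nonneg' hd hp hl, ?_⟩
  rw [integral_Ioi_of_hasDerivAt_of_nonneg' hd hp hl]
  simp

/-- With `sinh` in place of `cosh` the integral is exactly `exp (-s)`, and `0 ≤ cosh b - sinh b =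
exp (-b) ≤ 1`. -/
theorem besselD_bounds {s : ℝ} (hs : 0 < s) :
    Real.exp (-s) ≤ besselD s ∧ besselD s ≤ Real.exp (-s) + s * besselK0 s := by
  obtain ⟨hi, he⟩ := integral_mul_sinh_mul_exp hs
  have hD : besselD s = ∫ b in Ioi (0 : ℝ), s * (Real.cosh b * Real.exp (-(s * Real.cosh b))) := by
    rw [integral_const_mul]; rfl
  have hiD := (integrableOn_cosh_mul_exp hs).const_mul s
  constructor
  · rw [← he, hD]
    refine setIntegral_mono hi hiD fun b => ?_
    have := (Real.sinh_lt_cosh b).le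
    dsimp only
    gcongr
  · have hK : s * besselK0 s = ∫ b in Ioi (0 : ℝ), s * Real.exp (-(s * Real.cosh b)) := by
      rw [integral_const_mul]; rfl
    rw [← he, hD, hK, ← integral_add hi ((integrableOn_exp_neg_mul_cosh hs).const_mul s)]
    refine setIntegral_mono_on hiD (hi.add ((integrableOn_exp_neg_mul_cosh hs).const_mul s))
      measurableSet_Ioi fun b hb => ?_
    have h1 : Real.cosh b ≤ Real.sinh b + 1 := by
      have := Real.exp_le_one_iff.2 (show -b ≤ 0 by linarith [mem_Ioi.1 hb])
      rw [← Real.cosh_sub_sinh] at this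
      linarith
    calc _ ≤ s * ((Real.sinh b + 1) * Real.exp (-(s * Real.cosh b))) := by gcongr
      _ = _ := by ring

/-- The Hankel bound on the imaginary axis. The rate `3/4` suffices: `K₀⁴` is then `O(exp (-3s))`
for large `s`, which beats `I₀(xs) I₀(s) ≤ exp (2s)`. -/
theorem exists_besselK0_le : ∃ C : ℝ, 0 < C ∧ ∀ s, 0 < s →
    besselK0 s ≤ C * (1 + s ^ (-(1 / 8) : ℝ)) * Real.exp (-(3 / 4 * s)) := by
  have hcos : (3 / 4 : ℝ) < Real.cos (1 / 2) := by
    have := Real.one_sub_sq_div_two_le_cos (x := 1 / 2)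
    linarith
  have hpi : (1 / 2 : ℝ) < π / 2 := by linarith [Real.pi_gt_three]
  obtain ⟨C, hC, hb⟩ := exists_norm_hankel_le (η := 1 / 2) (by norm_num) hpi (by norm_num) hcos
  refine ⟨π / 2 * C, by positivity, fun s hs => ?_⟩
  have h := hb (s * Complex.I) (by simp [hs.ne']) (by simp) (by simpa using hs.le)
  rw [hankel_ofReal_mul_I (by norm_num) hpi hs] at h
  simp only [norm_mul, norm_neg, Complex.norm_I, mul_one, Complex.norm_real,
    Complex.mul_im, Complex.ofReal_re, Complex.ofReal_im, Complex.I_re,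
    Complex.I_im, mul_zero, add_zero] at h
  rw [Real.norm_of_nonneg (by positivity), Real.norm_of_nonneg (besselK0_nonneg s),
    Real.norm_of_nonneg hs.le] at h
  calc besselK0 s = π / 2 * (2 / π * besselK0 s) := by field_simp
    _ ≤ π / 2 * (C * (1 + s ^ (-(1 / 8) : ℝ)) * Real.exp (-(3 / 4 * s))) := by gcongr
    _ = _ := by ring

theorem continuousOn_besselK0 : ContinuousOn besselK0 (Ioi 0) :=
  fun _ hs => (hasDerivAt_besselK0 hs).continuousAt.continuousWithinAt

theorem continuousOn_besselD : ContinuousOn besselD (Ioi 0) :=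
  fun _ hs => (hasDerivAt_besselD hs).continuousAt.continuousWithinAt

theorem one_add_rpow_pow_five_le {s : ℝ} (hs : 0 < s) :
    (1 + s ^ (-(1 / 8) : ℝ)) ^ 5 ≤ 16 * (1 + s ^ (-(5 / 8) : ℝ)) := by
  have h1 := add_pow_le (zero_le_one (α := ℝ)) (show 0 ≤ s ^ (-(1 / 8) : ℝ) by positivity) 5
  have h2 : (s ^ (-(1 / 8) : ℝ)) ^ 5 = s ^ (-(5 / 8) : ℝ) := by
    rw [← Real.rpow_natCast, ← Real.rpow_mul hs.le]; norm_num
  rw [h2] at h1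
  norm_num at h1 ⊢
  exact h1

theorem integrableOn_pow_mul_rpow_mul_exp_neg (k : ℕ) : IntegrableOn
    (fun s : ℝ => s ^ k * ((1 + s ^ (-(5 / 8) : ℝ)) * Real.exp (-s))) (Ioi 0) := by
  have h1 := Real.GammaIntegral_convergent (s := k + 1) (by positivity)
  have h2 := Real.GammaIntegral_convergent (s := k + 3 / 8) (by positivity)
  refine IntegrableOn.congr_fun (h1.add h2) (fun s hs => ?_) measurableSet_Ioi
  have hs0 : (0 : ℝ) < s := hs
  simp only [Pi.add_apply]
  rw [show (k : ℝ) + 3 / 8 - 1 = k + -(5 / 8) by ring, Real.rpow_add hs0, add_sub_cancel_right,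
    Real.rpow_natCast]
  ring

theorem tendsto_pow_mul_rpow_mul_exp_neg_atTop (k : ℕ) : Tendsto
    (fun s : ℝ => s ^ k * ((1 + s ^ (-(5 / 8) : ℝ)) * Real.exp (-s))) atTop (𝓝 0) := by
  have h1 := tendsto_rpow_mul_exp_neg_mul_atTop_nhds_zero k 1 one_pos
  have h2 := tendsto_rpow_mul_exp_neg_mul_atTop_nhds_zero (k + -(5 / 8)) 1 one_pos
  have h := h1.add h2
  rw [add_zero] at h
  refine h.congr' ?_
  filter_upwards [eventually_gt_atTop 0] with s hs
  rw [Real.rpow_add hs, Real.rpow_natCast, neg_one_mul]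
  ring

theorem tendsto_pow_mul_rpow_mul_exp_neg_zero {k : ℕ} (hk : 1 ≤ k) : Tendsto
    (fun s : ℝ => s ^ k * ((1 + s ^ (-(5 / 8) : ℝ)) * Real.exp (-s))) (𝓝[>] 0) (𝓝 0) := by
  have hk' : (1 : ℝ) ≤ k := by exact_mod_cast hk
  have hc : Continuous fun s : ℝ => s ^ (k : ℝ) * Real.exp (-s) +
      s ^ (k + -(5 / 8) : ℝ) * Real.exp (-s) := by
    refine Continuous.add (Continuous.mul ?_ (by fun_prop)) (Continuous.mul ?_ (by fun_prop))
    · exact Real.continuous_rpow_const (by linarith)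
    · exact Real.continuous_rpow_const (by linarith)
  have h := (hc.tendsto 0).mono_left (nhdsWithin_le_nhds (s := Ioi 0))
  rw [Real.zero_rpow (by linarith), Real.zero_rpow (by linarith), zero_mul, add_zero] at h
  refine h.congr' ?_
  filter_upwards [self_mem_nhdsWithin] with s hs
  rw [Real.rpow_add hs, Real.rpow_natCast]
  ring

theorem exists_besselK0_pow_four_le : ∃ C : ℝ, 0 < C ∧ ∀ s, 0 < s →
    besselK0 s ^ 4 ≤ C * ((1 + s ^ (-(5 / 8) : ℝ)) * Real.exp (-(3 * s))) := by
  obtain ⟨C, hC, h⟩ := exists_besselK0_le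
  refine ⟨C ^ 4 * 16, by positivity, fun s hs => ?_⟩
  have hr : 0 ≤ s ^ (-(1 / 8) : ℝ) := by positivity
  calc _ ≤ (C * (1 + s ^ (-(1 / 8) : ℝ)) * Real.exp (-(3 / 4 * s))) ^ 4 := by
        gcongr
        · exact besselK0_nonneg s
        · exact h s hs
    _ = C ^ 4 * ((1 + s ^ (-(1 / 8) : ℝ)) ^ 4 * Real.exp (-(3 * s))) := by
        rw [mul_pow, mul_pow, ← Real.exp_nat_mul, mul_assoc]; congr 3; push_cast; ring
    _ ≤ C ^ 4 * ((16 * (1 + s ^ (-(5 / 8) : ℝ))) * Real.exp (-(3 * s))) := by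
        gcongr
        refine le_trans ?_ (one_add_rpow_pow_five_le hs)
        gcongr
        · linarith
        · norm_num
    _ = _ := by ring

/-- A common bound for the degree four and five monomials in `K₀` and `s K₁`. -/
theorem exists_besselK0_mul_besselD_le : ∃ C : ℝ, 0 < C ∧ ∀ a b : ℕ, 4 ≤ a + b → a + b ≤ 5 →
    ∀ s, 0 < s → besselK0 s ^ a * besselD s ^ b ≤
      C * ((1 + s ^ (-(5 / 8) : ℝ)) * Real.exp (-s)) := by
  obtain ⟨C, hC, h⟩ := exists_besselK0_le
  refine ⟨((1 + C) * (5 / 2)) ^ 5 * 16, by positivity, fun a b h4 h5 s hs => ?_⟩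
  have hr : 0 ≤ s ^ (-(1 / 8) : ℝ) := by positivity
  set u := 1 + s ^ (-(1 / 8) : ℝ) with hu
  have hu1 : 1 ≤ u := by linarith
  set E := Real.exp (-(3 / 4 * s)) with hE
  have hE0 : 0 < E := Real.exp_pos _
  have hE1 : E ≤ 1 := Real.exp_le_one_iff.2 (by linarith)
  set Y := (1 + C) * (1 + s) * u with hY
  have hY1 : 1 ≤ Y := by
    have : 1 ≤ (1 + C) * (1 + s) := by nlinarith
    nlinarith
  have hK : besselK0 s ≤ Y * E := by
    refine (h s hs).trans ?_
    gcongr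
    nlinarith
  have hD : besselD s ≤ Y * E := by
    have h1 : Real.exp (-s) ≤ E := Real.exp_le_exp.2 (by linarith)
    have h2 : s * besselK0 s ≤ s * (C * u * E) := by gcongr; exact h s hs
    have h3 : 1 + s * (C * u) ≤ Y := by
      have : Y = u + s * (C * u) + C * u + s * u := by rw [hY]; ring
      rw [this]
      have : 0 ≤ C * u + s * u := by positivity
      linarith
    have h4 : (1 + s * (C * u)) * E ≤ Y * E := by gcongr
    linarith [(besselD_bounds hs).2]
  have hK0 := besselK0_nonneg s
  have hD0 := besselD_nonneg hs.le
  -- The rate `2/5` is chosen so that `(1 + s)⁵` costs `exp (2s)` out of `E⁴ = exp (-3s)`, leaving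
  -- `exp (-s)`.
  have h1s : 1 + s ≤ 5 / 2 * Real.exp (2 / 5 * s) := by
    linarith [Real.add_one_le_exp (2 / 5 * s)]
  calc _ ≤ (Y * E) ^ a * (Y * E) ^ b := by gcongr
    _ = Y ^ (a + b) * E ^ (a + b) := by rw [← pow_add, mul_pow]
    _ ≤ Y ^ 5 * E ^ 4 := by
        gcongr ?_ * ?_
        · exact pow_le_pow_right₀ hY1 h5
        · exact pow_le_pow_of_le_one hE0.le hE1 h4
    _ = (1 + C) ^ 5 * (1 + s) ^ 5 * u ^ 5 * Real.exp (-(3 * s)) := by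
        rw [hY, hE, ← Real.exp_nat_mul, mul_pow, mul_pow]; congr 2; push_cast; ring
    _ ≤ (1 + C) ^ 5 * (5 / 2 * Real.exp (2 / 5 * s)) ^ 5 * (16 * (1 + s ^ (-(5 / 8) : ℝ))) *
        Real.exp (-(3 * s)) := by
        gcongr
        exact one_add_rpow_pow_five_le hs
    _ = ((1 + C) * (5 / 2)) ^ 5 * 16 * ((1 + s ^ (-(5 / 8) : ℝ)) *
        (Real.exp (2 / 5 * s) ^ 5 * Real.exp (-(3 * s)))) := by ring
    _ = _ := by
        rw [← Real.exp_nat_mul, ← Real.exp_add]; congr 4; push_cast; ring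

/-! ### Recurrences for the moments. -/

/-- The moments `∫₀^∞ sᵏ K₀(s)ᵃ (s K₁(s))ᵇ ds`. -/
noncomputable def besselMoment (a b k : ℕ) : ℝ :=
  ∫ s in Ioi (0 : ℝ), s ^ k * (besselK0 s ^ a * besselD s ^ b)

theorem integrableOn_besselMoment {a b : ℕ} (h4 : 4 ≤ a + b) (h5 : a + b ≤ 5) (k : ℕ) :
    IntegrableOn (fun s => s ^ k * (besselK0 s ^ a * besselD s ^ b)) (Ioi 0) := by
  obtain ⟨C, hC, h⟩ := exists_besselK0_mul_besselD_le
  refine Integrable.mono' ((integrableOn_pow_mul_rpow_mul_exp_neg k).const_mul C)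
    (ContinuousOn.aestronglyMeasurable ?_ measurableSet_Ioi) ?_
  · exact (continuousOn_pow k).mul ((continuousOn_besselK0.pow a).mul (continuousOn_besselD.pow b))
  · refine (ae_restrict_iff' measurableSet_Ioi).2 (Eventually.of_forall fun s hs => ?_)
    have hs0 : (0 : ℝ) < s := hs
    have hK0 := besselK0_nonneg s
    have hD0 := besselD_nonneg hs0.le
    rw [Real.norm_of_nonneg (by positivity), mul_left_comm C]
    exact mul_le_mul_of_nonneg_left (h a b h4 h5 s hs0) (by positivity)

/-- Integration by parts with `K₀' = -D/s` and `D' = -s K₀`, where `D = s K₁`. If `a = 0` or `b =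
0`, truncated subtraction produces a moment of degree five with coefficient zero, which is why
integrability was prepared up to degree five. -/
theorem besselMoment_rec {a b k : ℕ} (hab : a + b = 4) :
    (k + 1) * besselMoment a b k =
      a * besselMoment (a - 1) (b + 1) k + b * besselMoment (a + 1) (b - 1) (k + 2) := by
  obtain ⟨C, hC, hb⟩ := exists_besselK0_mul_besselD_le
  have h1 := integrableOn_besselMoment (k := k) hab.ge (hab.trans_le (by norm_num))
  have h2 : IntegrableOn (fun s => (a : ℝ) * (s ^ k * (besselK0 s ^ (a - 1) *
      besselD s ^ (b + 1)))) (Ioi 0) :=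
    (integrableOn_besselMoment (by omega) (by omega) k).const_mul _
  have h3 : IntegrableOn (fun s => (b : ℝ) * (s ^ (k + 2) * (besselK0 s ^ (a + 1) *
      besselD s ^ (b - 1)))) (Ioi 0) :=
    (integrableOn_besselMoment (by omega) (by omega) (k + 2)).const_mul _
  have hsum : ∫ s in Ioi (0 : ℝ), ((k + 1) * (s ^ k * (besselK0 s ^ a * besselD s ^ b)) -
      (a * (s ^ k * (besselK0 s ^ (a - 1) * besselD s ^ (b + 1))) +
      b * (s ^ (k + 2) * (besselK0 s ^ (a + 1) * besselD s ^ (b - 1))))) = 0 := by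
    have hle : ∀ s ∈ Ioi (0 : ℝ), s ^ (k + 1) * (besselK0 s ^ a * besselD s ^ b) ≤
        C * (s ^ (k + 1) * ((1 + s ^ (-(5 / 8) : ℝ)) * Real.exp (-s))) := by
      intro s hs
      have hs0 : (0 : ℝ) < s := hs
      rw [mul_left_comm C]
      exact mul_le_mul_of_nonneg_left (hb a b hab.ge (by omega) s hs0) (by positivity)
    have hnn : ∀ s ∈ Ioi (0 : ℝ), 0 ≤ s ^ (k + 1) * (besselK0 s ^ a * besselD s ^ b) := by
      intro s hs
      have hs0 : (0 : ℝ) < s := hs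
      have hK0 := besselK0_nonneg s
      have hD0 := besselD_nonneg hs0.le
      positivity
    have h := integral_Ioi_deriv_mul_eq_sub (a := 0) (a' := 0) (b' := 0)
      (u := fun s : ℝ => s ^ (k + 1)) (u' := fun s : ℝ => (k + 1) * s ^ k)
      (v := fun s => besselK0 s ^ a * besselD s ^ b)
      (v' := fun s => a * besselK0 s ^ (a - 1) * -(besselD s / s) * besselD s ^ b +
        besselK0 s ^ a * (b * besselD s ^ (b - 1) * -(s * besselK0 s))) ?_ ?_ ?_ ?_ ?_
    · rw [sub_zero] at h
      refine Eq.trans ?_ h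
      refine setIntegral_congr_fun measurableSet_Ioi fun s hs => ?_
      have hs0 : s ≠ 0 := ne_of_gt hs
      field_simp
      ring
    · intro s _
      refine (hasDerivAt_pow (k + 1) s).congr_deriv ?_
      push_cast
      simp
    · intro s hs
      exact ((hasDerivAt_besselK0 hs).pow a).mul ((hasDerivAt_besselD hs).pow b)
    · refine IntegrableOn.congr_fun ((h1.const_mul (k + 1 : ℝ)).sub (h2.add h3)) (fun s hs => ?_)
        measurableSet_Ioi
      have hs0 : s ≠ 0 := ne_of_gt hs
      simp only [Pi.sub_apply, Pi.add_apply, Pi.mul_apply]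
      field_simp
      ring
    · have := (tendsto_pow_mul_rpow_mul_exp_neg_zero (k := k + 1) (by omega)).const_mul C
      rw [mul_zero] at this
      refine squeeze_zero' ?_ ?_ this
      · filter_upwards [self_mem_nhdsWithin] with s hs using hnn s hs
      · filter_upwards [self_mem_nhdsWithin] with s hs using hle s hs
    · have := (tendsto_pow_mul_rpow_mul_exp_neg_atTop (k + 1)).const_mul C
      rw [mul_zero] at this
      refine squeeze_zero' ?_ ?_ this
      · filter_upwards [eventually_gt_atTop 0] with s hs using hnn s hs
      · filter_upwards [eventually_gt_atTop 0] with s hs using hle s hs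
  have h23 : IntegrableOn (fun s => (a : ℝ) * (s ^ k * (besselK0 s ^ (a - 1) *
      besselD s ^ (b + 1))) + (b : ℝ) * (s ^ (k + 2) * (besselK0 s ^ (a + 1) *
      besselD s ^ (b - 1)))) (Ioi 0) := h2.add h3
  rw [integral_sub (h1.const_mul (k + 1 : ℝ)) h23, integral_add h2 h3, integral_const_mul,
    integral_const_mul, integral_const_mul] at hsum
  exact sub_eq_zero.1 hsum

theorem tendsto_besselD_zero : Tendsto besselD (𝓝[>] 0) (𝓝 1) := by
  obtain ⟨C, hC, h⟩ := exists_besselK0_le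
  have he : Tendsto (fun s : ℝ => Real.exp (-s)) (𝓝[>] 0) (𝓝 1) := by
    have : Continuous fun s : ℝ => Real.exp (-s) := by fun_prop
    simpa using (this.tendsto 0).mono_left (nhdsWithin_le_nhds (s := Ioi 0))
  have h0 : Tendsto (fun s : ℝ => s * (C * (1 + s ^ (-(1 / 8) : ℝ)))) (𝓝[>] 0) (𝓝 0) := by
    have hc : Continuous fun s : ℝ => C * s + C * s ^ (7 / 8 : ℝ) :=
      (continuous_const.mul continuous_id).add
        (continuous_const.mul (Real.continuous_rpow_const (by norm_num)))
    have := (hc.tendsto 0).mono_left (nhdsWithin_le_nhds (s := Ioi 0))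
    rw [Real.zero_rpow (by norm_num), mul_zero, add_zero] at this
    refine this.congr' ?_
    filter_upwards [self_mem_nhdsWithin] with s hs
    rw [show (7 / 8 : ℝ) = 1 + -(1 / 8) by norm_num, Real.rpow_add hs, Real.rpow_one]
    ring
  have hu := he.add h0
  rw [add_zero] at hu
  refine tendsto_of_tendsto_of_tendsto_of_le_of_le' he hu ?_ ?_
  · filter_upwards [self_mem_nhdsWithin] with s hs using (besselD_bounds hs).1
  · filter_upwards [self_mem_nhdsWithin] with s hs
    have hs0 : (0 : ℝ) < s := hs
    refine (besselD_bounds hs).2.trans ?_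
    gcongr
    refine (h s hs).trans (mul_le_of_le_one_right (by positivity) ?_)
    exact Real.exp_le_one_iff.2 (by linarith)

/-- `(D⁴)' = -4 s K₀ D³`, and `D = s K₁` falls from `1` at `0⁺` to `0` at infinity. -/
theorem besselMoment_one_three_one : besselMoment 1 3 1 = 1 / 4 := by
  obtain ⟨C, hC, hb⟩ := exists_besselK0_mul_besselD_le
  have hi := integrableOn_besselMoment (a := 1) (b := 3) (by norm_num) (by norm_num) 1
  have h := integral_Ioi_deriv_mul_eq_sub (a := 0) (a' := 1) (b' := 0)
      (u := fun s : ℝ => besselD s ^ 4)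
      (u' := fun s : ℝ => -4 * (s ^ 1 * (besselK0 s ^ 1 * besselD s ^ 3)))
      (v := fun _ => 1) (v' := fun _ => 0) ?_ ?_ ?_ ?_ ?_
  · simp only [mul_one, mul_zero, add_zero] at h
    rw [integral_const_mul] at h
    change -4 * besselMoment 1 3 1 = 0 - 1 at h
    linarith
  · intro s hs
    refine ((hasDerivAt_besselD hs).pow 4).congr_deriv ?_
    push_cast
    norm_num
    ring
  · intro s _
    exact hasDerivAt_const s 1
  · refine IntegrableOn.congr_fun (hi.const_mul (-4)) (fun s _ => ?_) measurableSet_Ioi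
    simp
  · have := tendsto_besselD_zero.pow 4
    rw [one_pow] at this
    refine this.congr fun s => ?_
    simp
  · have := (tendsto_pow_mul_rpow_mul_exp_neg_atTop 0).const_mul C
    rw [mul_zero] at this
    refine squeeze_zero' ?_ ?_ this
    · filter_upwards [eventually_gt_atTop 0] with s hs
      have := besselD_nonneg hs.le
      simp only [Pi.mul_apply]
      positivity
    · filter_upwards [eventually_gt_atTop 0] with s hs
      simpa using hb 0 4 (by norm_num) (by norm_num) s hs

/-- The moment recurrence for `c_k = ∫₀^∞ sᵏ K₀(s)⁴ ds`. -/
theorem besselMoment_four_rec (k : ℕ) :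
    ((k : ℝ) + 1) ^ 5 * besselMoment 4 0 k
      - 4 * (k + 2) * (5 * (k + 2) ^ 2 + 3) * besselMoment 4 0 (k + 2)
      + 64 * (k + 3) * besselMoment 4 0 (k + 4) = 0 := by
  have e0 := besselMoment_rec (a := 4) (b := 0) (k := k) rfl
  have e1 := besselMoment_rec (a := 3) (b := 1) (k := k) rfl
  have e2 := besselMoment_rec (a := 2) (b := 2) (k := k) rfl
  have e3 := besselMoment_rec (a := 1) (b := 3) (k := k) rfl
  have e4 := besselMoment_rec (a := 0) (b := 4) (k := k) rfl
  have f0 := besselMoment_rec (a := 4) (b := 0) (k := k + 2) rfl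
  have f1 := besselMoment_rec (a := 3) (b := 1) (k := k + 2) rfl
  have f2 := besselMoment_rec (a := 2) (b := 2) (k := k + 2) rfl
  have g0 := besselMoment_rec (a := 4) (b := 0) (k := k + 4) rfl
  push_cast at e0 e1 e2 e3 e4 f0 f1 f2 g0
  norm_num at e0 e1 e2 e3 e4 f0 f1 f2 g0
  rw [show k + 2 + 2 = k + 4 by ring] at f1 f2
  generalize (k : ℝ) = x at *
  generalize besselMoment 4 0 k = c0 at *
  generalize besselMoment 3 1 k = c1 at *
  generalize besselMoment 2 2 k = c2 at *
  generalize besselMoment 1 3 k = c3 at *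
  generalize besselMoment 0 4 k = c4 at *
  generalize besselMoment 4 0 (k + 2) = d0 at *
  generalize besselMoment 3 1 (k + 2) = d1 at *
  generalize besselMoment 2 2 (k + 2) = d2 at *
  generalize besselMoment 1 3 (k + 2) = d3 at *
  generalize besselMoment 4 0 (k + 4) = p0 at *
  generalize besselMoment 3 1 (k + 4) = p1 at *
  -- Each relation expresses the moment with one more factor `D` through earlier ones. All moments
  -- thus reduce to those of `K₀⁴`, and the relation for `D⁴` closes the chain.
  have h1 : c1 = (x + 1) * c0 / 4 := by linarith
  have hd1 : d1 = (x + 3) * d0 / 4 := by linarith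
  have hp1 : p1 = (x + 5) * p0 / 4 := by linarith
  have h2 : c2 = ((x + 1) * c1 - d0) / 3 := by linarith
  have hd2 : d2 = ((x + 3) * d1 - p0) / 3 := by linarith
  have h3 : c3 = ((x + 1) * c2 - 2 * d1) / 2 := by linarith
  have hd3 : d3 = ((x + 3) * d2 - 2 * p1) / 2 := by linarith
  have h4 : c4 = (x + 1) * c3 - 3 * d2 := by linarith
  subst h4 h3 hd3 h2 hd2 h1 hd1 hp1
  linear_combination 24 * e4

/-- The analogue of `besselMoment_four_rec` at `k = -1`: the leading coefficient vanishes, but the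
boundary value `D(0⁺)⁴ = 1` leaves a constant. This inhomogeneous relation fixes the scale of the
odd moments. -/
theorem besselMoment_four_three : besselMoment 4 0 3 = besselMoment 4 0 1 / 4 - 3 / 16 := by
  have e0 := besselMoment_rec (a := 4) (b := 0) (k := 1) rfl
  have e1 := besselMoment_rec (a := 3) (b := 1) (k := 1) rfl
  have e2 := besselMoment_rec (a := 2) (b := 2) (k := 1) rfl
  have f0 := besselMoment_rec (a := 4) (b := 0) (k := 3) rfl
  have h := besselMoment_one_three_one
  norm_num at e0 e1 e2 f0
  rw [h] at e2
  linarith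

/-! ### The series of `I₀` and the Maclaurin expansion of `p₅`. -/

theorem two_div_pi_mul_integral_cos_pow (j : ℕ) :
    2 / π * ((∫ φ in (0 : ℝ)..(π / 2), Real.cos φ ^ (2 * j)) / (2 * j).factorial) =
      1 / (4 ^ j * (j.factorial : ℝ) ^ 2) := by
  rw [EulerSine.integral_cos_pow_eq, integral_sin_pow_even]
  have h : (∏ i ∈ Finset.range j, (2 * (i : ℝ) + 1) / (2 * i + 2)) / (2 * j).factorial =
      1 / (4 ^ j * (j.factorial : ℝ) ^ 2) := by
    induction j with
    | zero => simp
    | succ n ih =>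
      rw [Finset.prod_range_succ, show 2 * (n + 1) = 2 * n + 1 + 1 by ring, Nat.factorial_succ,
        Nat.factorial_succ, Nat.factorial_succ]
      rw [div_eq_iff (by positivity)] at ih
      rw [ih]
      push_cast
      field_simp
      ring
  rw [← h]
  field_simp

theorem hasSum_besselI0 (s : ℝ) :
    HasSum (fun j : ℕ => s ^ (2 * j) / (4 ^ j * (j.factorial : ℝ) ^ 2)) (besselI0 s) := by
  have h := (intervalIntegral.hasSum_integral_of_dominated_convergence (μ := volume)
    (a := 0) (b := π / 2)
    (F := fun (j : ℕ) φ => (s * Real.cos φ) ^ (2 * j) / (2 * j).factorial)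
    (f := fun φ => Real.cosh (s * Real.cos φ))
    (fun j _ => s ^ (2 * j) / (2 * j).factorial) ?_ ?_ ?_ ?_ ?_).mul_left (2 / π)
  · refine h.congr_fun fun j => ?_
    simp_rw [mul_pow, mul_div_assoc]
    rw [intervalIntegral.integral_const_mul, intervalIntegral.integral_div, mul_left_comm,
      two_div_pi_mul_integral_cos_pow]
    ring
  · exact fun j => Continuous.aestronglyMeasurable (by fun_prop)
  · refine fun j => Eventually.of_forall fun φ _ => ?_
    rw [norm_div, norm_pow, norm_mul, mul_pow, pow_mul ‖s‖, Real.norm_eq_abs s, sq_abs, ← pow_mul,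
      RCLike.norm_natCast]
    have hs : 0 ≤ s ^ (2 * j) := by rw [pow_mul]; positivity
    gcongr
    exact mul_le_of_le_one_right hs (pow_le_one₀ (norm_nonneg _) (Real.abs_cos_le_one _))
  · exact Eventually.of_forall fun φ _ => (Real.hasSum_cosh s).summable
  · exact intervalIntegrable_const
  · exact Eventually.of_forall fun φ _ => Real.hasSum_cosh _

theorem continuous_besselI0 : Continuous besselI0 := by
  unfold besselI0
  exact continuous_const.mul
    (intervalIntegral.continuous_parametric_intervalIntegral_of_continuous' (by fun_prop) _ _)

theorem one_le_besselI0 (s : ℝ) : 1 ≤ besselI0 s := by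
  have := le_hasSum (hasSum_besselI0 s) 0 fun j _ => by rw [pow_mul]; positivity
  simpa using this

theorem besselI0_le_exp {s : ℝ} (hs : 0 ≤ s) : besselI0 s ≤ Real.exp s := by
  have h := norm_besselJC_le (s * Complex.I)
  rw [besselJC_ofReal_mul_I, Complex.norm_real] at h
  simp only [Complex.mul_im, Complex.ofReal_re, Complex.ofReal_im, Complex.I_re, Complex.I_im,
    mul_one, mul_zero, add_zero, abs_of_nonneg hs] at h
  exact (le_abs_self _).trans h

theorem integral_Ioi_pos {f : ℝ → ℝ} (hf : IntegrableOn f (Ioi 0)) (h : ∀ s ∈ Ioi (0 : ℝ), 0 < f s) :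
    0 < ∫ s in Ioi (0 : ℝ), f s := by
  rw [setIntegral_pos_iff_support_of_nonneg_ae ?_ hf]
  · rw [inter_eq_self_of_subset_right (show Ioi 0 ⊆ Function.support f from fun s hs => (h s hs).ne'), Real.volume_Ioi]
    exact ENNReal.zero_lt_top
  · exact (ae_restrict_iff' measurableSet_Ioi).2 (Eventually.of_forall fun s hs => (h s hs).le)

/-- Termwise integration of the power series of `I₀` against a nonnegative weight. -/
theorem hasSum_integral_besselI0_mul {g : ℝ → ℝ} {x : ℝ} (hg : ∀ s ∈ Ioi (0 : ℝ), 0 ≤ g s)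
    (hgc : ContinuousOn g (Ioi 0))
    (hi : IntegrableOn (fun s => s * besselI0 (x * s) * g s) (Ioi 0)) :
    HasSum (fun j : ℕ => x ^ (2 * j) / (4 ^ j * (j.factorial : ℝ) ^ 2) *
      ∫ s in Ioi (0 : ℝ), s ^ (2 * j + 1) * g s)
      (∫ s in Ioi (0 : ℝ), s * besselI0 (x * s) * g s) := by
  have hsum : ∀ s, HasSum (fun j : ℕ => x ^ (2 * j) / (4 ^ j * (j.factorial : ℝ) ^ 2) *
      (s ^ (2 * j + 1) * g s)) (s * besselI0 (x * s) * g s) := by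
    intro s
    refine (((hasSum_besselI0 (x * s)).mul_left s).mul_right (g s)).congr_fun fun j => ?_
    ring
  have h := hasSum_integral_of_dominated_convergence (μ := volume.restrict (Ioi 0))
    (F := fun (j : ℕ) s => x ^ (2 * j) / (4 ^ j * (j.factorial : ℝ) ^ 2) *
      (s ^ (2 * j + 1) * g s))
    (f := fun s => s * besselI0 (x * s) * g s)
    (fun j s => x ^ (2 * j) / (4 ^ j * (j.factorial : ℝ) ^ 2) * (s ^ (2 * j + 1) * g s))
    ?_ ?_ ?_ ?_ ?_
  · refine h.congr_fun fun j => ?_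
    rw [integral_const_mul]
  · exact fun j => (continuousOn_const.mul ((continuousOn_pow _).mul hgc)).aestronglyMeasurable
      measurableSet_Ioi
  · refine fun j => (ae_restrict_iff' measurableSet_Ioi).2 (Eventually.of_forall fun s hs => ?_)
    have hs0 : (0 : ℝ) < s := hs
    have := hg s hs
    rw [Real.norm_of_nonneg]
    rw [pow_mul]
    positivity
  · exact Eventually.of_forall fun s => (hsum s).summable
  · exact hi.congr (Eventually.of_forall fun s => (hsum s).tsum_eq.symm)
  · exact Eventually.of_forall hsum

theorem continuousOn_besselI0_mul : ContinuousOn (fun s => besselI0 s * besselK0 s ^ 4) (Ioi 0) :=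
  continuous_besselI0.continuousOn.mul (continuousOn_besselK0.pow 4)

theorem integrableOn_besselI0_mul {x : ℝ} (hx0 : 0 ≤ x) (hx1 : x ≤ 1) (k : ℕ) :
    IntegrableOn (fun s => s ^ k * besselI0 (x * s) * (besselI0 s * besselK0 s ^ 4)) (Ioi 0) := by
  obtain ⟨C, hC, h⟩ := exists_besselK0_pow_four_le
  refine Integrable.mono' ((integrableOn_pow_mul_rpow_mul_exp_neg k).const_mul C)
    (ContinuousOn.aestronglyMeasurable ?_ measurableSet_Ioi) ?_
  · exact ((continuousOn_pow k).mul (Continuous.continuousOn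
      (continuous_besselI0.comp (by fun_prop)))).mul continuousOn_besselI0_mul
  · refine (ae_restrict_iff' measurableSet_Ioi).2 (Eventually.of_forall fun s hs => ?_)
    have hs0 : (0 : ℝ) < s := hs
    have h1 := one_le_besselI0 s
    have h2 := one_le_besselI0 (x * s)
    have h3 : besselI0 (x * s) ≤ Real.exp s :=
      (besselI0_le_exp (by positivity)).trans (Real.exp_le_exp.2 (mul_le_of_le_one_left hs0.le hx1))
    rw [Real.norm_of_nonneg (by positivity)]
    calc _ ≤ s ^ k * Real.exp s * (Real.exp s *
          (C * ((1 + s ^ (-(5 / 8) : ℝ)) * Real.exp (-(3 * s))))) := by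
          gcongr
          · exact besselI0_le_exp hs0.le
          · exact h s hs0
      _ = C * (s ^ k * ((1 + s ^ (-(5 / 8) : ℝ)) *
          (Real.exp s * Real.exp s * Real.exp (-(3 * s))))) := by ring
      _ = _ := by rw [← Real.exp_add, ← Real.exp_add]; congr 4; ring

/-- The coefficients of the Maclaurin expansion of `p₅`. -/
noncomputable def kluyverCoeff5 (k : ℕ) : ℝ :=
  30 / π ^ 4 * (1 / (4 ^ k * (k.factorial : ℝ) ^ 2) *
    ∫ s in Ioi (0 : ℝ), s ^ (2 * k + 1) * (besselI0 s * besselK0 s ^ 4))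

theorem kluyverCoeff5_pos (k : ℕ) : 0 < kluyverCoeff5 k := by
  have hi : IntegrableOn (fun s => s ^ (2 * k + 1) * (besselI0 s * besselK0 s ^ 4)) (Ioi 0) := by
    refine (integrableOn_besselI0_mul le_rfl zero_le_one (2 * k + 1)).congr
      (Eventually.of_forall fun s => ?_)
    have : besselI0 0 = 1 := by simp [besselI0]
    simp [this]
  have := integral_Ioi_pos hi fun s hs => by
    have h1 := one_le_besselI0 s
    have h2 := besselK0_pos hs
    have h3 : (0 : ℝ) < s := hs
    positivity
  unfold kluyverCoeff5
  positivity

/-- The integral converges up to `x = 1`, although it is identified with `p₅` only for `x < 1`; the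
endpoint gives summability of the coefficients. -/
theorem hasSum_kluyverCoeff5 {x : ℝ} (hx0 : 0 ≤ x) (hx1 : x ≤ 1) :
    HasSum (fun k : ℕ => kluyverCoeff5 k * x ^ (2 * k)) (30 / π ^ 4 *
      ∫ s in Ioi (0 : ℝ), s * besselI0 (x * s) * (besselI0 s * besselK0 s ^ 4)) := by
  have hi := integrableOn_besselI0_mul hx0 hx1 1
  simp only [pow_one] at hi
  refine ((hasSum_integral_besselI0_mul (fun s _ => ?_) continuousOn_besselI0_mul hi).mul_left
    (30 / π ^ 4)).congr_fun fun k => ?_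
  · have := one_le_besselI0 s
    positivity
  · unfold kluyverCoeff5
    ring

theorem hasSum_kluyverP5 {x : ℝ} (hx0 : 0 ≤ x) (hx1 : x < 1) :
    HasSum (fun k : ℕ => kluyverCoeff5 k * x ^ (2 * k + 1)) (kluyverP5 x) := by
  have h := (hasSum_kluyverCoeff5 hx0 hx1.le).mul_left x
  have e : x * (30 / π ^ 4 *
      ∫ s in Ioi (0 : ℝ), s * besselI0 (x * s) * (besselI0 s * besselK0 s ^ 4)) =
      kluyverP5 x := by
    rw [kluyverP5_eq_integral hx0 hx1]
    simp_rw [mul_assoc]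
    ring
  rw [e] at h
  refine h.congr_fun fun k => ?_
  ring

theorem isOddMaclaurinExpansion_kluyverP5 :
    IsOddMaclaurinExpansion kluyverP5 kluyverCoeff5 :=
  ⟨1, one_pos, fun _ hx => hasSum_kluyverP5 hx.1 hx.2⟩

/-- Near `0`, on both sides by oddness, `p₅(x) = x h(x²)` with `h` a convergent power series. So
`p₅` is analytic at `0`, its derivative is continuous there, and the value is `h(0)`. -/
theorem isDerivZeroPlus_kluyverP5 : IsDerivZeroPlus kluyverP5 (kluyverCoeff5 0) := by
  have hsum : Summable kluyverCoeff5 := by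
    simpa using (hasSum_kluyverCoeff5 zero_le_one le_rfl).summable
  set h : ℝ → ℝ := fun y => ∑' k, kluyverCoeff5 k * y ^ k with hh
  have hs : ∀ y : ℝ, |y| ≤ 1 → HasSum (fun k => kluyverCoeff5 k * y ^ k) (h y) := by
    intro y hy
    refine (Summable.of_norm_bounded hsum fun k => ?_).hasSum
    rw [norm_mul, norm_pow, Real.norm_of_nonneg (kluyverCoeff5_pos k).le]
    exact mul_le_of_le_one_right (kluyverCoeff5_pos k).le (pow_le_one₀ (abs_nonneg y) hy)
  have han : AnalyticAt ℝ h 0 := by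
    refine ⟨FormalMultilinearSeries.ofScalars ℝ kluyverCoeff5, ?_⟩
    rw [hasFPowerSeriesAt_iff]
    filter_upwards [Metric.ball_mem_nhds (0 : ℝ) one_pos] with y hy
    rw [mem_ball_zero_iff, Real.norm_eq_abs] at hy
    rw [zero_add]
    refine (hs y hy.le).congr_fun fun k => ?_
    rw [FormalMultilinearSeries.coeff_ofScalars, smul_eq_mul, mul_comm]
  have heq : kluyverP5 =ᶠ[𝓝 0] fun x => x * h (x ^ 2) := by
    filter_upwards [Metric.ball_mem_nhds (0 : ℝ) one_pos] with x hx
    rw [mem_ball_zero_iff, Real.norm_eq_abs] at hx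
    have key : ∀ x : ℝ, 0 ≤ x → x < 1 → kluyverP5 x = x * h (x ^ 2) := by
      intro x hx0 hx1
      have hx2 : |x ^ 2| ≤ 1 := by
        rw [abs_pow, abs_of_nonneg hx0]
        exact pow_le_one₀ hx0 hx1.le
      have h1 := (hs (x ^ 2) hx2).mul_left x
      refine (hasSum_kluyverP5 hx0 hx1).unique (h1.congr_fun fun k => ?_)
      ring
    rcases le_total 0 x with h0 | h0
    · exact key x h0 (by rwa [abs_of_nonneg h0] at hx)
    · have := key (-x) (by linarith) (by rwa [abs_of_nonpos h0] at hx)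
      rw [kluyverP5_neg, neg_sq] at this
      linarith
  have han2 : AnalyticAt ℝ (fun x => x * h (x ^ 2)) 0 := by
    refine analyticAt_id.mul (AnalyticAt.fun_comp ?_ (analyticAt_id.pow 2))
    simpa using han
  have han3 : AnalyticAt ℝ kluyverP5 0 := han2.congr heq.symm
  have hd : deriv kluyverP5 0 = kluyverCoeff5 0 := by
    have h1 : HasDerivAt (fun x => h (x ^ 2)) (deriv (fun x => h (x ^ 2)) 0) 0 := by
      have : AnalyticAt ℝ (fun x => h (x ^ 2)) 0 :=
        AnalyticAt.fun_comp (by simpa using han) (analyticAt_id.pow 2)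
      exact this.differentiableAt.hasDerivAt
    have h2 : HasDerivAt (fun x => x * h (x ^ 2)) _ 0 := (hasDerivAt_id 0).mul h1
    rw [heq.deriv_eq, h2.deriv]
    have h0 : h 0 = kluyverCoeff5 0 := by
      simpa using (hs 0 (by simp)).unique
        (hasSum_single 0 fun k hk => by rw [zero_pow hk, mul_zero])
    simp [h0]
  refine ⟨?_, ?_⟩
  · exact (han3.eventually_analyticAt.mono fun x hx => hx.differentiableAt).filter_mono
      nhdsWithin_le_nhds
  · rw [← hd]
    exact han3.deriv.continuousAt.tendsto.mono_left nhdsWithin_le_nhds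

/-- For `x < 1` the positive terms make each partial sum a lower bound of `p₅(x)`; continuity of
`p₅`, known from Kluyver's integral itself, carries this to `x = 1`. -/
theorem sum_kluyverCoeff5_le_kluyverP5_one (n : ℕ) :
    ∑ k ∈ Finset.range n, kluyverCoeff5 k ≤ kluyverP5 1 := by
  have hl : Tendsto kluyverP5 (𝓝[<] 1) (𝓝 (kluyverP5 1)) :=
    (continuous_kluyverP5.tendsto 1).mono_left nhdsWithin_le_nhds
  have hr : Tendsto (fun x : ℝ => ∑ k ∈ Finset.range n, kluyverCoeff5 k * x ^ (2 * k + 1)) (𝓝[<] 1)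
      (𝓝 (∑ k ∈ Finset.range n, kluyverCoeff5 k)) := by
    have : Continuous fun x : ℝ => ∑ k ∈ Finset.range n, kluyverCoeff5 k * x ^ (2 * k + 1) := by
      fun_prop
    simpa using (this.tendsto 1).mono_left (nhdsWithin_le_nhds (s := Iio 1))
  refine le_of_tendsto_of_tendsto hr hl ?_
  filter_upwards [Ioo_mem_nhdsLT zero_lt_one] with x hx
  refine sum_le_hasSum _ (fun k _ => ?_) (hasSum_kluyverP5 hx.1.le hx.2)
  have := kluyverCoeff5_pos k
  have := hx.1
  positivity

/-! ### Numerical enclosure of `r_1`. -/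

theorem besselMoment_pos (k : ℕ) : 0 < besselMoment 4 0 k :=
  integral_Ioi_pos (integrableOn_besselMoment (by norm_num) (by norm_num) k) fun s hs => by
    have h2 := besselK0_pos hs
    have h3 : (0 : ℝ) < s := hs
    rw [pow_zero, mul_one]
    positivity

/-- Replace one factor `s K₀` by the larger `s K₁`; the resulting moment is an exact multiple of the
previous one by parts. This supplies the crude ratio bound that starts the backward recurrence. -/
theorem besselMoment_succ_le (k : ℕ) :
    besselMoment 4 0 (k + 1) ≤ (k + 1) / 4 * besselMoment 4 0 k := by
  have e0 := besselMoment_rec (a := 4) (b := 0) (k := k) rfl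
  have h : besselMoment 4 0 (k + 1) ≤ besselMoment 3 1 k := by
    refine setIntegral_mono_on (integrableOn_besselMoment (by norm_num) (by norm_num) _)
      (integrableOn_besselMoment (by norm_num) (by norm_num) _) measurableSet_Ioi fun s hs => ?_
    have h3 : (0 : ℝ) < s := hs
    have hK := besselK0_nonneg s
    have hD : s * besselK0 s ≤ besselD s := by
      refine mul_le_mul_of_nonneg_left ?_ h3.le
      refine setIntegral_mono (integrableOn_exp_neg_mul_cosh h3) (integrableOn_cosh_mul_exp h3)
        fun b => ?_
      exact le_mul_of_one_le_left (Real.exp_nonneg _) (Real.one_le_cosh b)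
    calc _ = s ^ k * (besselK0 s ^ 3 * (s * besselK0 s)) := by ring
      _ ≤ s ^ k * (besselK0 s ^ 3 * besselD s) := by gcongr
      _ = _ := by ring
  norm_num at e0
  linarith

theorem hasSum_besselMoment :
    HasSum (fun j : ℕ => 1 / (4 ^ j * (j.factorial : ℝ) ^ 2) * besselMoment 4 0 (2 * j + 3))
      (∫ s in Ioi (0 : ℝ), s ^ 3 * (besselI0 s * besselK0 s ^ 4)) := by
  have hi := integrableOn_besselI0_mul (x := 0) le_rfl zero_le_one 3
  have h0 : besselI0 0 = 1 := by simp [besselI0]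
  simp only [zero_mul, h0, mul_one] at hi
  -- Now the factor `I₀(s)` itself is expanded, hence `x = 1` and a weight without `I₀`.
  have h := hasSum_integral_besselI0_mul (x := 1) (g := fun s => s ^ 2 * besselK0 s ^ 4)
    (fun s _ => by positivity) ((continuousOn_pow 2).mul (continuousOn_besselK0.pow 4))
    (hi.congr (Eventually.of_forall fun s => by simp only [one_mul]; ring))
  have e : ∫ s in Ioi (0 : ℝ), s ^ 3 * (besselI0 s * besselK0 s ^ 4) =
      ∫ s in Ioi (0 : ℝ), s * besselI0 (1 * s) * (s ^ 2 * besselK0 s ^ 4) := by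
    congr 1; ext s; rw [one_mul]; ring
  rw [e]
  refine h.congr_fun fun j => ?_
  rw [one_pow, besselMoment]
  congr 1
  refine integral_congr_ae (Eventually.of_forall fun s => ?_)
  ring

/-- The odd moments `∫₀^∞ s^{2j+1} K₀(s)⁴ ds`. -/
noncomputable def oddMoment (j : ℕ) : ℝ := besselMoment 4 0 (2 * j + 1)

theorem oddMoment_pos (j : ℕ) : 0 < oddMoment j := besselMoment_pos _

theorem oddMoment_one : oddMoment 1 = oddMoment 0 / 4 - 3 / 16 := besselMoment_four_three

theorem oddMoment_succ_le (j : ℕ) :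
    oddMoment (j + 1) ≤ (2 * j + 2) * (2 * j + 3) / 16 * oddMoment j := by
  have h1 := besselMoment_succ_le (2 * j + 1)
  have h2 := besselMoment_succ_le (2 * j + 1 + 1)
  push_cast at h1 h2
  calc oddMoment (j + 1) ≤ (2 * j + 1 + 1 + 1) / 4 * besselMoment 4 0 (2 * j + 1 + 1) := h2
    _ ≤ (2 * j + 1 + 1 + 1) / 4 * ((2 * j + 1 + 1) / 4 * oddMoment j) := by gcongr; exact h1
    _ = _ := by ring

theorem oddMoment_rec (j : ℕ) :
    (2 * j + 2 : ℝ) ^ 5 * oddMoment j = 4 * (2 * j + 3) * (5 * (2 * j + 3) ^ 2 + 3) *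
      oddMoment (j + 1) - 64 * (2 * j + 4) * oddMoment (j + 2) := by
  have h := besselMoment_four_rec (2 * j + 1)
  push_cast at h
  rw [show 2 * j + 1 + 2 = 2 * (j + 1) + 1 by ring,
    show 2 * j + 1 + 4 = 2 * (j + 2) + 1 by ring] at h
  change _ * oddMoment j - _ * oddMoment (j + 1) + _ * oddMoment (j + 2) = 0 at h
  linear_combination h

/-- The moment recurrence, run backwards, contracts enclosures of the ratios of odd moments. -/
theorem oddMoment_ratio_step (j : ℕ) {l u l' u' : ℝ}
    (h : l * oddMoment (j + 1) ≤ oddMoment (j + 2) ∧ oddMoment (j + 2) ≤ u * oddMoment (j + 1))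
    (hu : 0 < 4 * (2 * j + 3) * (5 * (2 * j + 3) ^ 2 + 3) - 64 * (2 * j + 4) * u)
    (hl' : l' * (4 * (2 * j + 3) * (5 * (2 * j + 3) ^ 2 + 3) - 64 * (2 * j + 4) * l) ≤
      (2 * j + 2 : ℝ) ^ 5)
    (hu' : (2 * j + 2 : ℝ) ^ 5 ≤
      u' * (4 * (2 * j + 3) * (5 * (2 * j + 3) ^ 2 + 3) - 64 * (2 * j + 4) * u)) :
    l' * oddMoment j ≤ oddMoment (j + 1) ∧ oddMoment (j + 1) ≤ u' * oddMoment j := by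
  have hr := oddMoment_rec j
  have h0 := oddMoment_pos j
  have h1 := oddMoment_pos (j + 1)
  have hlu : l ≤ u := le_of_mul_le_mul_right (h.1.trans h.2) h1
  have hc : (0 : ℝ) ≤ 64 * (2 * j + 4) := by positivity
  have hl : 0 < 4 * (2 * j + 3) * (5 * (2 * j + 3) ^ 2 + 3) - 64 * (2 * j + 4) * l := by
    have := mul_le_mul_of_nonneg_left hlu hc
    linarith
  have e1 := mul_le_mul_of_nonneg_left h.1 hc
  have e2 := mul_le_mul_of_nonneg_left h.2 hc
  have e3 := mul_le_mul_of_nonneg_right hl' h0.le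
  have e4 := mul_le_mul_of_nonneg_right hu' h0.le
  constructor
  · refine le_of_mul_le_mul_left ?_ hl
    linarith
  · refine le_of_mul_le_mul_left ?_ hu
    linarith

/-- Comparison with a geometric series: `(1/10)/(1 - 1/10) = 1/9`. -/
theorem tsum_tail_le {T : ℕ → ℝ} {S : ℝ} (n : ℕ) (hT : HasSum T S)
    (hr : ∀ j, n ≤ j → T (j + 1) ≤ T j / 10) :
    S ≤ ∑ j ∈ Finset.range (n + 1), T j + T n / 9 := by
  have hg : ∀ i, T (i + (n + 1)) ≤ T n / 10 * (1 / 10) ^ i := by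
    intro i
    induction i with
    | zero => simpa using hr n le_rfl
    | succ i ih =>
      have := hr (i + (n + 1)) (by omega)
      rw [show i + 1 + (n + 1) = i + (n + 1) + 1 by ring]
      rw [pow_succ]
      linarith
  have h1 := (hasSum_nat_add_iff' (n + 1)).2 hT
  have h2 := (hasSum_geometric_of_lt_one (r := (1 / 10 : ℝ)) (by norm_num) (by norm_num)).mul_left
    (T n / 10)
  have := hasSum_le hg h1 h2
  norm_num at this
  linarith

theorem integral_cube_mul_besselI0_mul_bounds :
    0.0859372906907 ≤ ∫ s in Ioi (0 : ℝ), s ^ 3 * (besselI0 s * besselK0 s ^ 4) ∧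
    ∫ s in Ioi (0 : ℝ), s ^ 3 * (besselI0 s * besselK0 s ^ 4) ≤ 0.0859372906925 := by
  -- The initial enclosure is only positivity and `42 · 43 / 16 = 451.5 / 4`. Each backward step
  -- shrinks the width by a factor of more than four; the decimals below are the resulting endpoints
  -- rounded outwards.
  have h20 : 0 * oddMoment 20 ≤ oddMoment 21 ∧ oddMoment 21 ≤ 451.5 / 4 * oddMoment 20 := by
    have h1 := oddMoment_succ_le 20
    have h2 := oddMoment_pos 21
    norm_num at h1 ⊢
    exact ⟨h2.le, by linarith⟩
  have h19 : 74.2614467058086375 * oddMoment 19 ≤ oddMoment 20 ∧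
      oddMoment 20 ≤ 95.2111754117139500 * oddMoment 19 :=
    oddMoment_ratio_step 19 h20 (by norm_num) (by norm_num) (by norm_num)
  have h18 : 79.4944234467331137 * oddMoment 18 ≤ oddMoment 19 ∧
      oddMoment 19 ≤ 84.0150005828294667 * oddMoment 18 :=
    oddMoment_ratio_step 18 h19 (by norm_num) (by norm_num) (by norm_num)
  have h17 : 73.7236345920044815 * oddMoment 17 ≤ oddMoment 18 ∧
      oddMoment 18 ≤ 74.7252922391297207 * oddMoment 17 :=
    oddMoment_ratio_step 17 h18 (by norm_num) (by norm_num) (by norm_num)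
  have h16 : 66.0340300921656875 * oddMoment 16 ≤ oddMoment 17 ∧
      oddMoment 17 ≤ 66.2562596996873732 * oddMoment 16 :=
    oddMoment_ratio_step 16 h17 (by norm_num) (by norm_num) (by norm_num)
  have h15 : 58.3103104117960290 * oddMoment 15 ≤ oddMoment 16 ∧
      oddMoment 16 ≤ 58.3593522494041686 * oddMoment 15 :=
    oddMoment_ratio_step 15 h16 (by norm_num) (by norm_num) (by norm_num)
  have h14 : 50.9677064037533789 * oddMoment 14 ≤ oddMoment 15 ∧
      oddMoment 15 ≤ 50.9784456077765322 * oddMoment 14 :=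
    oddMoment_ratio_step 14 h15 (by norm_num) (by norm_num) (by norm_num)
  have h13 : 44.0986184862370264 * oddMoment 13 ≤ oddMoment 14 ∧
      oddMoment 14 ≤ 44.1009484870865134 * oddMoment 13 :=
    oddMoment_ratio_step 13 h14 (by norm_num) (by norm_num) (by norm_num)
  have h12 : 37.7235310013485619 * oddMoment 12 ≤ oddMoment 13 ∧
      oddMoment 13 ≤ 37.7240311024095449 * oddMoment 12 :=
    oddMoment_ratio_step 12 h13 (by norm_num) (by norm_num) (by norm_num)
  have h11 : 31.8469234868035225 * oddMoment 11 ≤ oddMoment 12 ∧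
      oddMoment 12 ≤ 31.8470294832494935 * oddMoment 11 :=
    oddMoment_ratio_step 11 h12 (by norm_num) (by norm_num) (by norm_num)
  have h10 : 26.4697234059101379 * oddMoment 10 ≤ oddMoment 11 ∧
      oddMoment 11 ≤ 26.4697455403371944 * oddMoment 10 :=
    oddMoment_ratio_step 10 h11 (by norm_num) (by norm_num) (by norm_num)
  have h9 : 21.5920595470866660 * oddMoment 9 ≤ oddMoment 10 ∧
      oddMoment 10 ≤ 21.5920640876442853 * oddMoment 9 :=
    oddMoment_ratio_step 9 h10 (by norm_num) (by norm_num) (by norm_num)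
  have h8 : 17.2138578912181686 * oddMoment 8 ≤ oddMoment 9 ∧
      oddMoment 9 ≤ 17.2138588026266905 * oddMoment 8 :=
    oddMoment_ratio_step 8 h9 (by norm_num) (by norm_num) (by norm_num)
  have h7 : 13.3349550804982380 * oddMoment 7 ≤ oddMoment 8 ∧
      oddMoment 8 ≤ 13.3349552585510230 * oddMoment 7 :=
    oddMoment_ratio_step 7 h8 (by norm_num) (by norm_num) (by norm_num)
  have h6 : 9.9550937583272610 * oddMoment 6 ≤ oddMoment 7 ∧
      oddMoment 7 ≤ 9.9550937919241652 * oddMoment 6 :=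
    oddMoment_ratio_step 6 h7 (by norm_num) (by norm_num) (by norm_num)
  have h5 : 7.0738665743765113 * oddMoment 5 ≤ oddMoment 6 ∧
      oddMoment 6 ≤ 7.0738665804301260 * oddMoment 5 :=
    oddMoment_ratio_step 5 h6 (by norm_num) (by norm_num) (by norm_num)
  have h4 : 4.6905920226771119 * oddMoment 4 ≤ oddMoment 5 ∧
      oddMoment 5 ≤ 4.6905920237000076 * oddMoment 4 :=
    oddMoment_ratio_step 4 h5 (by norm_num) (by norm_num) (by norm_num)
  have h3 : 2.8040339568285780 * oddMoment 3 ≤ oddMoment 4 ∧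
      oddMoment 4 ≤ 2.8040339569856606 * oddMoment 3 :=
    oddMoment_ratio_step 3 h4 (by norm_num) (by norm_num) (by norm_num)
  have h2 : 1.4116789455909246 * oddMoment 2 ≤ oddMoment 3 ∧
      oddMoment 3 ≤ 1.4116789456115364 * oddMoment 2 :=
    oddMoment_ratio_step 2 h3 (by norm_num) (by norm_num) (by norm_num)
  have h1 : 0.5074544048831338 * oddMoment 1 ≤ oddMoment 2 ∧
      oddMoment 2 ≤ 0.5074544048851243 * oddMoment 1 :=
    oddMoment_ratio_step 1 h2 (by norm_num) (by norm_num) (by norm_num)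
  have h0 : 0.0717341344469191 * oddMoment 0 ≤ oddMoment 1 ∧
      oddMoment 1 ≤ 0.0717341344470011 * oddMoment 0 :=
    oddMoment_ratio_step 0 h1 (by norm_num) (by norm_num) (by norm_num)
  set S := ∫ s in Ioi (0 : ℝ), s ^ 3 * (besselI0 s * besselK0 s ^ 4)
  set T : ℕ → ℝ := fun j => 1 / (4 ^ j * (j.factorial : ℝ) ^ 2) * oddMoment (j + 1) with hT
  have hS : HasSum T S := hasSum_besselMoment
  have hT0 : ∀ j, 0 ≤ T j := fun j => by
    have := oddMoment_pos (j + 1)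
    positivity
  -- The ratio of terms is at most `(2j + 4)(2j + 5)/16` divided by `4(j + 1)²`, which tends to
  -- `1/16`.
  have hr : ∀ j, 11 ≤ j → T (j + 1) ≤ T j / 10 := by
    intro j hj
    have h1 := oddMoment_succ_le (j + 1)
    have hj' : (11 : ℝ) ≤ j := by exact_mod_cast hj
    have hq := oddMoment_pos (j + 1)
    push_cast at h1
    have h2 : (2 * ((j : ℝ) + 1) + 2) * (2 * (j + 1) + 3) / 16 ≤ 4 * (j + 1) ^ 2 / 10 := by
      nlinarith
    calc T (j + 1) ≤ 1 / (4 ^ (j + 1) * ((j + 1).factorial : ℝ) ^ 2) *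
          (4 * (j + 1) ^ 2 / 10 * oddMoment (j + 1)) := by
          refine mul_le_mul_of_nonneg_left (h1.trans ?_) (by positivity)
          gcongr
      _ = _ := by
          rw [hT, Nat.factorial_succ]
          push_cast
          field_simp
          ring
  have hlow := sum_le_hasSum (Finset.range 12) (fun j _ => hT0 j) hS
  have hupp := tsum_tail_le 11 hS hr
  -- Together with `h0` this encloses `oddMoment 0`; the ratio enclosures then propagate to all
  -- twelve terms, so only linear arithmetic remains.
  have h01 := oddMoment_one
  simp only [hT, Finset.sum_range_succ, Finset.sum_range_zero, Nat.factorial] at hlow hupp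
  norm_num at hlow hupp
  constructor
  · linarith [h0.1, h1.1, h2.1, h3.1, h4.1, h5.1, h6.1, h7.1, h8.1, h9.1, h10.1, h11.1]
  · linarith [h0.2, h1.2, h2.2, h3.2, h4.2, h5.2, h6.2, h7.2, h8.2, h9.2, h10.2, h11.2]

theorem kluyverCoeff5_one_bounds :
    (0.006616730259 : ℝ) ≤ kluyverCoeff5 1 ∧ kluyverCoeff5 1 < (0.006616730260 : ℝ) := by
  obtain ⟨h1, h2⟩ := integral_cube_mul_besselI0_mul_bounds
  have hc : kluyverCoeff5 1 = 30 / 4 *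
      (∫ s in Ioi (0 : ℝ), s ^ 3 * (besselI0 s * besselK0 s ^ 4)) / π ^ 4 := by
    simp only [kluyverCoeff5, pow_one, Nat.factorial_one, Nat.cast_one, one_pow, mul_one]
    ring
  have p1 : (3.14159265358979 : ℝ) ^ 4 < π ^ 4 := by
    have := Real.pi_gt_d20
    gcongr
    linarith
  have p2 : π ^ 4 < (3.1415926535898 : ℝ) ^ 4 := by
    have := Real.pi_lt_d20
    gcongr
    linarith
  have hp : 0 < π ^ 4 := by positivity
  rw [hc, le_div_iff₀ hp, div_lt_iff₀ hp]
  norm_num at p1 p2 h1 h2 ⊢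
  constructor <;> linarith

theorem mainTheorem7 :
    (∀ x : ℝ, MeasureTheory.IntegrableOn (kluyverIntegrand5 x) (Set.Ioi 0)) ∧
    ∃ (L : ℝ) (r : ℕ → ℝ),
      IsDerivZeroPlus kluyverP5 L ∧
      IsOddMaclaurinExpansion kluyverP5 r ∧
      L < kluyverP5 1 ∧
      r 1 < kluyverP5 1 - L ∧
      (0.006616730259 : ℝ) ≤ r 1 ∧ r 1 < (0.006616730260 : ℝ) := by
  -- Three terms are taken so that `r_2 > 0` makes the bound by `r_1` strict.
  have h := sum_kluyverCoeff5_le_kluyverP5_one 3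
  simp only [Finset.sum_range_succ, Finset.sum_range_zero, zero_add] at h
  have h1 := kluyverCoeff5_pos 1
  have h2 := kluyverCoeff5_pos 2
  exact ⟨integrableOn_kluyverIntegrand5, kluyverCoeff5 0, kluyverCoeff5,
    isDerivZeroPlus_kluyverP5, isOddMaclaurinExpansion_kluyverP5, by linarith, by linarith,
    kluyverCoeff5_one_bounds⟩
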